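/- **Setting.** Let $x_{t+1}=f(x_t,u_t)$, $x_0=\xi$, be a discrete-time system with $x_t\in\mathbb R^d$, $u_t\in\mathbb R^m$, $f:\mathbb R^d\times\mathbb R^m\to\mathbb R^d$ measurable. For a policy $\pi:\mathbb R^d\to\mathbb R^m$ let $x_t^{\pi}(\xi;\{\Delta_s\})$ be the state at time $t$ under $u_t=\pi(x_t)+\Delta_t$, and $x_t^\pi(\xi)$ the state for $\Delta\equiv 0$. Initial conditions are drawn from a probability distribution $\mathcal D$ supported in a compact set $\mathcal X\subset\mathbb R^d$. For an expert $\pi_\star$ and a horizon $T\ge 1$ the imitation gap is $\Gamma_T(\xi;\pi)=\max_{1\le t\le T}\|x_t^{\pi}(\xi)-x_t^{\pi_\star}(\xi)\|$, and for $p\in\mathbb N$ the $p$-TaSIL loss is $$\ell_p^{\pi_\star}(\xi;\pi)=\frac1{p+1}\sum_{j=0}^p\max_{0\le t\le T-1}\big\|\partial_x^j(\pi-\pi_\star)(x_t^{\pi_\star}(\xi))\big\|$$ (Euclidean norms of vectors, operator norms of tensors). A function $\gamma:[0,\infty)\to[0,\infty)$ is of class $\mathcal K$ if it is continuous, strictly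 increasing and $\gamma(0)=0$; $\beta(x,t)$ is of class $\mathcal{KL}$ if it is continuous, $\beta(\cdot,t)$ is of class $\mathcal K$ for each $t$, and $\beta(x,\cdot)$ is decreasing (non-strictly) for each $x$. **Policy class.** Let $\pi(x,\theta)$, $x\in\mathbb R^d$, $\theta\in\mathbb R^q$, be $p+2$ times continuously differentiable in $(x,\theta)$ with $\pi(0,\theta)=0$ for all $\theta$, and let $\Pi_{\theta,p}=\{\pi(\cdot,\theta):\|\theta\|\le B_\theta\}$. For $j=0,\dots,p$ put $B_j=\sup_{\|x\|\le B_X,\|\theta\|\le B_\theta}\|\partial_x^j\pi(x,\theta)\|$, and let $L_j\ge\sup_{\|x\|\le B_X,\|\theta\|\le B_\theta}\|\partial_x^{j+1}\partial_\theta\pi(x,\theta)\|$ be such that $B_\theta B_XL_j\ge 2B_j$ (the supremum is enlarged if necessary). Expressions $B_j\log(\cdots)$ are $0$ when $B_j=0$. **Assumptions.** 1. $\pi_\star\in\Pi_{\theta,p}$, and $\|x_t^{\pi_\star}(\xi)\|\le B_X$ for all $t\in\mathbb N$, $\xi\in\mathcal X$, where $B_X>0$. 2. The expert closed loop is $\eta$-locally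 $\delta$-ISS, $\eta>0$, with gain $\gamma$: $\gamma$ is of class $\mathcal K$ and there is $\beta$ of class $\mathcal{KL}$ with $$\|x_t^{\pi_\star}(\xi_1;\{\Delta_s\})-x_t^{\pi_\star}(\xi_2)\|\le\beta(\|\xi_1-\xi_2\|,t)+\gamma\Big(\max_{0\le k\le t-1}\|\Delta_k\|\Big)$$ for all $\xi_1,\xi_2\in\mathcal X$, all $t\in\mathbb N$ and all $\{\Delta_s\}$ with $\sup_s\|\Delta_s\|\le\eta$. Moreover $\gamma(x)=O(x^{1/r})$ as $x\to0^+$, with $r\ge1$ and $p+1-r>0$. 3. There is a constant $L_{\partial^p\pi}\ge0$ such that every $\bar\pi\in\Pi_{\theta,p}$ satisfies, for all $x,x_0\in\mathbb R^d$, $$\Big\|\bar\pi(x)-\sum_{j=0}^p\tfrac1{j!}\partial_x^j\bar\pi(x_0)(x-x_0)^{\otimes j}\Big\|\le\frac{L_{\partial^p\pi}}{(p+1)!}\|x-x_0\|^{p+1}.$$ 4. $\mu>0$ and $0<\alpha\le\frac12$ satisfy $\big(\frac\alpha\mu\big)^rp!\le2$ and $$2\frac{L_{\partial^p\pi}}{(p+1)!}x^{p+1}+\Big(\frac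 x\mu\Big)^r\le\gamma^{-1}(x)\quad\text{for all }0\le x\le\alpha ,$$ where $\gamma^{-1}(x)=+\infty$ if $x$ exceeds all values of $\gamma$. **Theorem.** There is a universal constant $C>0$ such that the following holds in this setting. Let $n\ge1$, and let $\hat\pi$ be a measurable choice, depending on the sample $\xi_1,\dots,\xi_n\overset{\text{i.i.d.}}\sim\mathcal D$, of a minimizer of the empirical risk $\frac1n\sum_{i=1}^n\ell_p^{\pi_\star}(\xi_i;\pi)$ over $\pi\in\Pi_{\theta,p}$. Let $\delta\in(0,1)$, $$\kappa_{\alpha,j}=\Big(\frac\mu\alpha\Big)^r\frac{pq}{j!},\qquad \kappa_{\eta,j}=\Big(\frac{L_{\partial^p\pi}}{(p+1)!}\frac{\mu^{p+1}}{(j!)^{(p+1)/r}}+\frac1{j!}\Big)\frac{pq}{\eta\delta},$$ and assume $$n\ge C\max_{0\le j\le p}\max\Big\{B_j\frac{\kappa_{\alpha,j}}\delta\log\Big(C\,\frac{\kappa_{\alpha,j}B_\theta B_j^{-1}B_XL_j}{\delta}\Big),\;B_j\frac{\kappa_{\eta,j}}\delta\log\Big(C\,\frac{\kappa_{\eta,j}B_\theta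 B_j^{-1}B_XL_j}{\delta}\Big)\Big\}.$$ Then with probability at least $1-\delta$ over $\xi_1,\dots,\xi_n$ and an independent $\xi\sim\mathcal D$, $$\Gamma_T(\xi;\hat\pi)\le C\,\mu\max_{0\le j\le p}\Big(\frac{p}{j!\,\delta}\cdot\frac{B_jq\log(B_\theta B_j^{-1}B_XL_jn)}{n}\Big)^{1/r}.$$ -/

import Mathlib

open MeasureTheory Set Filter Topology

noncomputable section

namespace TaSIL

/-- The Euclidean space of dimension `k` (Euclidean norm). -/
abbrev Euc (k : ℕ) : Type := EuclideanSpace ℝ (Fin k)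

/-! ### Closed-loop trajectories -/

/-- `perturbedTraj f pol Δ ξ t` is the state at time `t` of
`x (t+1) = f (x t) (pol (x t) + Δ t)`, `x 0 = ξ`. -/
def perturbedTraj {d m : ℕ} (f : Euc d → Euc m → Euc d) (pol : Euc d → Euc m)
    (Δ : ℕ → Euc m) (ξ : Euc d) : ℕ → Euc d
  | 0 => ξ
  | t + 1 => f (perturbedTraj f pol Δ ξ t) (pol (perturbedTraj f pol Δ ξ t) + Δ t)

/-- The unperturbed closed-loop trajectory under the policy `pol`. -/
def traj {d m : ℕ} (f : Euc d → Euc m → Euc d) (pol : Euc d → Euc m)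
    (ξ : Euc d) (t : ℕ) : Euc d :=
  perturbedTraj f pol (fun _ => 0) ξ t

/-- The imitation gap: the maximum over `1 ≤ t ≤ T` of the distance between the states of the
two closed loops (here `t` runs over `Fin T`, shifted by one). -/
def imitationGap {d m : ℕ} (f : Euc d → Euc m → Euc d) (polStar pol : Euc d → Euc m)
    (T : ℕ) (ξ : Euc d) : ℝ :=
  ⨆ t : Fin T, ‖traj f pol ξ (t + 1) - traj f polStar ξ (t + 1)‖

/-! ### Comparison functions and incremental input-to-state stability -/

/-- Class `K` functions on `[0, ∞)`. -/
structure IsClassK (γ : ℝ → ℝ) : Prop where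
  continuousOn : ContinuousOn γ (Ici 0)
  strictMonoOn : StrictMonoOn γ (Ici 0)
  map_zero : γ 0 = 0

/-- Class `KL` functions on `[0, ∞) × [0, ∞)`. -/
structure IsClassKL (β : ℝ → ℝ → ℝ) : Prop where
  continuousOn : ContinuousOn (fun z : ℝ × ℝ => β z.1 z.2) (Ici 0 ×ˢ Ici 0)
  classK : ∀ t : ℝ, 0 ≤ t → IsClassK (fun x => β x t)
  antitoneOn : ∀ x : ℝ, 0 ≤ x → AntitoneOn (β x) (Ici 0)

/-- The closed loop of `f` under `pol` is `η`-locally incrementally input-to-state stable on the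
set `X` of initial conditions, with gain `γ`. For `t = 0` the maximum over the empty set of
perturbations is `0`. -/
def IsLocallyDISS {d m : ℕ} (f : Euc d → Euc m → Euc d) (X : Set (Euc d))
    (pol : Euc d → Euc m) (η : ℝ) (γ : ℝ → ℝ) : Prop :=
  IsClassK γ ∧ ∃ β : ℝ → ℝ → ℝ, IsClassKL β ∧
    ∀ ξ₁ ∈ X, ∀ ξ₂ ∈ X, ∀ Δ : ℕ → Euc m, (∀ t, ‖Δ t‖ ≤ η) → ∀ t : ℕ,
      ‖perturbedTraj f pol Δ ξ₁ t - perturbedTraj f pol (fun _ => 0) ξ₂ t‖ ≤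
        β ‖ξ₁ - ξ₂‖ (t : ℝ) + γ (⨆ k : Fin t, ‖Δ k‖)

/-! ### Parametric policy classes -/

/-- A parametric family `pol x θ` of policies, jointly `p + 2` times continuously differentiable
in `(x, θ)`, with `pol 0 θ = 0` for all `θ`. -/
structure IsPolicyFamily {d m q : ℕ} (p : ℕ) (pol : Euc d → Euc q → Euc m) : Prop where
  contDiff : ContDiff ℝ ((p + 2 : ℕ) : ℕ∞) (fun z : Euc d × Euc q => pol z.1 z.2)
  map_zero : ∀ θ, pol 0 θ = 0

/-- The policy class: the members of the family with parameter of norm at most `Bθ`. -/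
def policyClass {d m q : ℕ} (pol : Euc d → Euc q → Euc m) (Bθ : ℝ) : Set (Euc d → Euc m) :=
  {π' | ∃ θ : Euc q, ‖θ‖ ≤ Bθ ∧ π' = fun x => pol x θ}

/-- `B_j`: the supremum over `‖x‖ ≤ BX`, `‖θ‖ ≤ Bθ` of the operator norm of the `j`-th
derivative in `x` of `pol x θ`. -/
def derivBound {d m q : ℕ} (pol : Euc d → Euc q → Euc m) (BX Bθ : ℝ) (j : ℕ) : ℝ :=
  sSup ((fun z : Euc d × Euc q => ‖iteratedFDeriv ℝ j (fun x => pol x z.2) z.1‖) ''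
    (Metric.closedBall 0 BX ×ˢ Metric.closedBall 0 Bθ))

/-- The supremum over `‖x‖ ≤ BX`, `‖θ‖ ≤ Bθ` of the operator norm of the mixed derivative of
`pol x θ`, of order `j + 1` in `x` and of order one in `θ`. -/
def mixedDerivBound {d m q : ℕ} (pol : Euc d → Euc q → Euc m) (BX Bθ : ℝ) (j : ℕ) : ℝ :=
  sSup ((fun z : Euc d × Euc q =>
      ‖iteratedFDeriv ℝ (j + 1) (fun x => fderiv ℝ (fun θ => pol x θ) z.2) z.1‖) ''
    (Metric.closedBall 0 BX ×ˢ Metric.closedBall 0 Bθ))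

/-- The `p`-th order Taylor polynomial of `g` at `x₀`, evaluated at `x`. -/
def taylorPoly {d m : ℕ} (p : ℕ) (g : Euc d → Euc m) (x₀ x : Euc d) : Euc m :=
  ∑ j ∈ Finset.range (p + 1),
    (1 / (j.factorial : ℝ)) • iteratedFDeriv ℝ j g x₀ (fun _ => x - x₀)

/-- `g` is `p` times continuously differentiable and its `p`-th order Taylor remainder is at most
`Lp / (p+1)! * ‖x - x₀‖ ^ (p+1)` everywhere. -/
def HasTaylorBound {d m : ℕ} (p : ℕ) (Lp : ℝ) (g : Euc d → Euc m) : Prop :=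
  ContDiff ℝ (p : ℕ∞) g ∧ ∀ x x₀ : Euc d,
    ‖g x - taylorPoly p g x₀ x‖ ≤ Lp / ((p + 1).factorial : ℝ) * ‖x - x₀‖ ^ (p + 1)

/-- The relation
`2 * Lp / (p+1)! * x ^ (p+1) + (x / μ) ^ r ≤ γ⁻¹ x` for all `0 ≤ x ≤ α`.
The inverse of the class `K` function `γ` is a function on its range `γ '' [0, ∞)`; at an `x`
outside of the range (above all values of `γ`), `γ⁻¹ x` counts as `+∞`. -/
def NeighborhoodRelation (p : ℕ) (Lp r μ α : ℝ) (γ : ℝ → ℝ) : Prop :=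
  ∀ x : ℝ, 0 ≤ x → x ≤ α → ∀ y : ℝ, 0 ≤ y → γ y = x →
    2 * (Lp / ((p + 1).factorial : ℝ)) * x ^ (p + 1) + (x / μ) ^ r ≤ y

/-! ### The loss and its empirical minimizers -/

/-- The `p`-TaSIL loss of the policy `pol` on the expert trajectory started at `ξ`: the average
over `0 ≤ j ≤ p` of the maxima over `0 ≤ t ≤ T - 1` of the norms of the `j`-th derivatives of
`pol - polStar` at the `t`-th expert state. -/
def tasilLoss {d m : ℕ} (f : Euc d → Euc m → Euc d) (polStar : Euc d → Euc m) (p T : ℕ)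
    (ξ : Euc d) (pol : Euc d → Euc m) : ℝ :=
  1 / ((p : ℝ) + 1) * ∑ j ∈ Finset.range (p + 1),
    ⨆ t : Fin T, ‖iteratedFDeriv ℝ j (fun x => pol x - polStar x) (traj f polStar ξ t)‖

/-- The empirical `p`-TaSIL risk on the initial conditions `ξs`. -/
def empiricalRisk {d m n : ℕ} (f : Euc d → Euc m → Euc d) (polStar : Euc d → Euc m) (p T : ℕ)
    (ξs : Fin n → Euc d) (pol : Euc d → Euc m) : ℝ :=
  1 / (n : ℝ) * ∑ i, tasilLoss f polStar p T (ξs i) pol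

/-- `polHat` minimizes the empirical `p`-TaSIL risk over the set `P` of policies. -/
def IsERM {d m n : ℕ} (f : Euc d → Euc m → Euc d) (polStar : Euc d → Euc m) (p T : ℕ)
    (P : Set (Euc d → Euc m)) (ξs : Fin n → Euc d) (polHat : Euc d → Euc m) : Prop :=
  polHat ∈ P ∧ ∀ π' ∈ P,
    empiricalRisk f polStar p T ξs polHat ≤ empiricalRisk f polStar p T ξs π'

/-! ### The quantities of the burn-in condition and of the rate -/

/-- `(μ / α) ^ r * (p q / j!)`. -/
def kappaAlpha (p q : ℕ) (r μ α : ℝ) (j : ℕ) : ℝ :=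
  (μ / α) ^ r * ((p : ℝ) * q / (j.factorial : ℝ))

/-- `(Lp / (p+1)! * μ ^ (p+1) / (j!) ^ ((p+1)/r) + 1 / j!) * (p q / (η δ))`. -/
def kappaEta (p q : ℕ) (r μ Lp η δ : ℝ) (j : ℕ) : ℝ :=
  (Lp / ((p + 1).factorial : ℝ) *
      (μ ^ (p + 1) / (j.factorial : ℝ) ^ (((p : ℝ) + 1) / r)) + 1 / (j.factorial : ℝ)) *
    ((p : ℝ) * q / (η * δ))

/-- `B κ / δ * log (C κ c / δ)`. -/
def burnInTerm (C B κ c δ : ℝ) : ℝ :=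
  B * κ / δ * Real.log (C * (κ * c / δ))

end TaSIL

end

/-! Realizability reduces learning to consistency. The expert lies in the class and has zero loss,
so an empirical minimizer reproduces the derivatives of the expert of every order `j ≤ p` at all
states of the sampled expert trajectories (`IsERM.iteratedFDeriv_eq_zero`). It remains to pass to a
fresh trajectory, and from derivative errors to states.

Probability, one order `j` at a time (`measure_derivError_le`). The constant `L j` bounds a
derivative mixed in `x` and `θ`, so it only makes increments in `x` of the derivative error
Lipschitz in `θ`. Values are recovered by anchoring at the first sampled initial condition, where
the error of the learned policy vanishes. A finite net of the parameter ball then suffices, each net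
point having an error set that depends on the first sample. An error set of mass above `ρ` is missed
by the `n` other samples with probability at most `exp (-ρ n)`; a union bound over the net follows
(`measure_consistent_selection_le`). Since the empirical error is exactly zero, the accuracy is of
order `log n / n`.

Stability (`imitationGap_le`). Suppose that the error of order `j` along the expert trajectory is at
most `j! S / 2`, and put `ε = μ S^(1/r)`, so `S = (ε/μ)^r`. While the two closed loops are
`ε`-close, Taylor expansion bounds the policy error by `S + 2 Lp/(p+1)! ε^(p+1)`. By the
neighborhood relation this is at most `γ⁻¹ ε`, so incremental stability returns the distance `ε` at
the next time, and induction closes.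

Each order is controlled at two accuracies: one of order `log n / n`, which gives the rate, and a
fixed one, made reachable by the burn-in, which keeps `ε ≤ α` and the policy error below `η`. This
makes `2 (p+1)` events, each failing with probability at most `δ / (2 (p+1))`. -/

namespace TaSIL

/-! ### Mixed derivatives and second differences -/

section Calculus

variable {E G H : Type*} [NormedAddCommGroup E] [NormedSpace ℝ E] [NormedAddCommGroup G]
  [NormedSpace ℝ G] [NormedAddCommGroup H] [NormedSpace ℝ H]

/-- A directional derivative commutes with the iterated derivatives. -/
lemma fderiv_iteratedFDeriv_apply {F : E → H} (a : E) {n : ℕ}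
    (hF : ContDiff ℝ ((n + 1 : ℕ) : ℕ∞) F) (z : E) :
    fderiv ℝ (iteratedFDeriv ℝ n F) z a = iteratedFDeriv ℝ n (fun y => fderiv ℝ F y a) z := by
  induction n generalizing z with
  | zero =>
    ext w
    have h0 : iteratedFDeriv ℝ 0 F = (continuousMultilinearCurryFin0 ℝ E H).symm ∘ F :=
      iteratedFDeriv_zero_eq_comp
    rw [h0, LinearIsometryEquiv.comp_fderiv]
    simp
  | succ n ih =>
    have hF' : ContDiff ℝ ((n + 1 : ℕ) : ℕ∞) F := hF.of_le (by exact_mod_cast Nat.le_succ _)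
    have hG : ContDiff ℝ 2 (iteratedFDeriv ℝ n F) := by
      refine hF.iteratedFDeriv_right (m := 2) (i := n) ?_
      push_cast
      rw [add_assoc, one_add_one_eq_two, add_comm]
    -- The induction step exchanges `a` with the newest slot `w 0`; this is the symmetry of the
    -- second derivative of the `n`-th iterated derivative.
    have hsymm : IsSymmSndFDerivAt ℝ (iteratedFDeriv ℝ n F) z :=
      (hG.contDiffAt).isSymmSndFDerivAt (by simp)
    have hdd : DifferentiableAt ℝ (fderiv ℝ (iteratedFDeriv ℝ n F)) z :=
      (hG.fderiv_right (m := 1) (by norm_num)).differentiable (by norm_num) z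
    ext w
    have hdn : DifferentiableAt ℝ (iteratedFDeriv ℝ (n + 1) F) z :=
      hF.differentiable_iteratedFDeriv (by exact_mod_cast Nat.lt_succ_self _) z
    have e1 : fderiv ℝ (iteratedFDeriv ℝ (n + 1) F) z a w =
        fderiv ℝ (fun y => iteratedFDeriv ℝ (n + 1) F y w) z a := by
      have := (ContinuousMultilinearMap.apply ℝ (fun _ : Fin (n + 1) => E) H w).hasFDerivAt.comp z
        hdn.hasFDerivAt
      exact (congrFun (congrArg DFunLike.coe this.fderiv) a).symm
    have e2 : fderiv ℝ (fun y => iteratedFDeriv ℝ (n + 1) F y w) z a =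
        fderiv ℝ (fderiv ℝ (iteratedFDeriv ℝ n F)) z a (w 0) (Fin.tail w) := by
      have := (ContinuousMultilinearMap.apply ℝ (fun _ : Fin n => E) H (Fin.tail w)).hasFDerivAt.comp
        z (hdd.hasFDerivAt.clm_apply (hasFDerivAt_const (w 0) z))
      refine (congrFun (congrArg DFunLike.coe this.fderiv) a).trans ?_
      simp
    rw [e1, e2, iteratedFDeriv_succ_apply_left]
    have h2 : iteratedFDeriv ℝ n (fun y => fderiv ℝ F y a)
        = fun y => fderiv ℝ (iteratedFDeriv ℝ n F) y a := by
      ext1 y; exact (ih hF' y).symm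
    rw [h2]
    have h3 : fderiv ℝ (fun y => fderiv ℝ (iteratedFDeriv ℝ n F) y a) z (w 0)
        = fderiv ℝ (fderiv ℝ (iteratedFDeriv ℝ n F)) z (w 0) a := by
      rw [fderiv_clm_apply hdd (differentiableAt_const a)]
      simp
    rw [h3, hsymm.eq (w 0) a]

lemma iteratedFDeriv_slice {F : E × G → H} {n : ℕ∞} (hF : ContDiff ℝ n F) {i : ℕ}
    (hi : (i : ℕ∞) ≤ n) (x : E) (θ : G) :
    iteratedFDeriv ℝ i (fun y => F (y, θ)) x =
      (iteratedFDeriv ℝ i F (x, θ)).compContinuousLinearMap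
        (fun _ => ContinuousLinearMap.inl ℝ E G) := by
  have h1 : (fun y => F (y, θ)) =
      (fun z => F (z + ((0 : E), θ))) ∘ ContinuousLinearMap.inl ℝ E G := by
    ext y; simp
  have hF' : ContDiff ℝ n (fun z => F (z + ((0 : E), θ))) := by fun_prop
  rw [h1, ContinuousLinearMap.iteratedFDeriv_comp_right _ hF' x (by exact_mod_cast hi),
    iteratedFDeriv_comp_add_right]
  simp

lemma continuous_iteratedFDeriv_slice {F : E × G → H} {n : ℕ∞} (hF : ContDiff ℝ n F) {i : ℕ}
    (hi : (i : ℕ∞) ≤ n) :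
    Continuous (fun z : E × G => iteratedFDeriv ℝ i (fun y => F (y, z.2)) z.1) := by
  have h1 : (fun z : E × G => iteratedFDeriv ℝ i (fun y => F (y, z.2)) z.1) = fun z =>
      ContinuousMultilinearMap.compContinuousLinearMapL (F := H)
        (fun _ : Fin i => ContinuousLinearMap.inl ℝ E G) (iteratedFDeriv ℝ i F z) := by
    ext1 z
    exact iteratedFDeriv_slice hF hi z.1 z.2
  rw [h1]
  exact (ContinuousLinearMap.continuous _).comp
    (hF.continuous_iteratedFDeriv (by exact_mod_cast hi))

lemma hasFDerivAt_slice_right {F : E × G → H} (hF : Differentiable ℝ F) (x : E) (θ : G) :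
    HasFDerivAt (fun θ => F (x, θ))
      ((fderiv ℝ F (x, θ)).comp (ContinuousLinearMap.inr ℝ E G)) θ :=
  (hF (x, θ)).hasFDerivAt.comp θ (hasFDerivAt_prodMk_right x θ)

lemma contDiff_fderiv_slice_right {F : E × G → H} {n : ℕ}
    (hF : ContDiff ℝ ((n + 1 : ℕ) : ℕ∞) F) :
    ContDiff ℝ (n : ℕ∞) (fun z : E × G => fderiv ℝ (fun θ => F (z.1, θ)) z.2) := by
  have hd : Differentiable ℝ F := hF.differentiable (by simp)
  have h1 : (fun z : E × G => fderiv ℝ (fun θ => F (z.1, θ)) z.2) =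
      fun z => (fderiv ℝ F z).comp (ContinuousLinearMap.inr ℝ E G) := by
    ext1 z
    exact (hasFDerivAt_slice_right hd z.1 z.2).fderiv
  rw [h1]
  exact (hF.fderiv_right (by norm_cast)).clm_comp contDiff_const

/-- A bound on the mixed derivatives makes the derivatives in the first variable Lipschitz in the
second one. -/
lemma norm_iteratedFDeriv_slice_sub_le {F : E × G → H} {n : ℕ}
    (hF : ContDiff ℝ ((n + 1 : ℕ) : ℕ∞) F) {s : Set G} (hs : Convex ℝ s) {x : E} {L : ℝ}
    (hL : ∀ θ ∈ s, ‖iteratedFDeriv ℝ n (fun x => fderiv ℝ (fun θ => F (x, θ)) θ) x‖ ≤ L)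
    {θ θ' : G} (hθ : θ ∈ s) (hθ' : θ' ∈ s) :
    ‖iteratedFDeriv ℝ n (fun y => F (y, θ')) x - iteratedFDeriv ℝ n (fun y => F (y, θ)) x‖
      ≤ L * ‖θ' - θ‖ := by
  have hd : Differentiable ℝ F := hF.differentiable (by simp)
  have hn : ContDiff ℝ (n : ℕ∞) F := hF.of_le (by exact_mod_cast Nat.le_succ _)
  have hL0 : 0 ≤ L := (norm_nonneg _).trans (hL θ hθ)
  have hslice := contDiff_fderiv_slice_right hF
  refine ContinuousMultilinearMap.opNorm_le_bound (by positivity) fun w => ?_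
  have hdn : Differentiable ℝ (iteratedFDeriv ℝ n F) :=
    hF.differentiable_iteratedFDeriv (by norm_cast; exact Nat.lt_succ_self _)
  let w' : Fin n → E × G := fun i => (w i, 0)
  have hval : ∀ θ, iteratedFDeriv ℝ n (fun y => F (y, θ)) x w =
      iteratedFDeriv ℝ n F (x, θ) w' := by
    intro θ
    rw [iteratedFDeriv_slice hn le_rfl]
    rfl
  let φ : G → H := fun θ => iteratedFDeriv ℝ n F (x, θ) w'
  let φ' : G → G →L[ℝ] H := fun θ =>
    ((ContinuousMultilinearMap.apply ℝ (fun _ : Fin n => E × G) H w').comp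
      (fderiv ℝ (iteratedFDeriv ℝ n F) (x, θ))).comp (ContinuousLinearMap.inr ℝ E G)
  have hφ : ∀ θ, HasFDerivAt φ (φ' θ) θ := by
    intro θ
    have h1 := hasFDerivAt_slice_right hdn x θ
    exact (ContinuousMultilinearMap.apply ℝ (fun _ : Fin n => E × G) H w').hasFDerivAt.comp θ h1
  have hbound : ∀ θ ∈ s, ‖φ' θ‖ ≤ L * ∏ i, ‖w i‖ := by
    intro θ hθ
    refine ContinuousLinearMap.opNorm_le_bound _ (by positivity) fun v => ?_
    -- The direction `(0, v)` is commuted past the `n` slots in `x`, which turns the `θ`-derivative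
    -- of `φ` into the mixed derivative bounded by `L`.
    have e1 : φ' θ v = iteratedFDeriv ℝ n (fun x => fderiv ℝ (fun θ => F (x, θ)) θ) x w v := by
      have e2 : φ' θ v = iteratedFDeriv ℝ n (fun y => fderiv ℝ F y ((0 : E), v)) (x, θ) w' := by
        rw [← fderiv_iteratedFDeriv_apply _ hF]
        rfl
      have hc : ContDiff ℝ (n : ℕ∞) (fun y => fderiv ℝ F y ((0 : E), v)) :=
        (hF.fderiv_right (by norm_cast)).clm_apply contDiff_const
      have e3 : iteratedFDeriv ℝ n (fun y => fderiv ℝ F y ((0 : E), v)) (x, θ) w' =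
          iteratedFDeriv ℝ n (fun y => fderiv ℝ F (y, θ) ((0 : E), v)) x w := by
        rw [iteratedFDeriv_slice (F := fun y => fderiv ℝ F y ((0 : E), v)) hc le_rfl x θ]
        rfl
      have e4 : (fun y => fderiv ℝ F (y, θ) ((0 : E), v)) =
          (ContinuousLinearMap.apply ℝ H v) ∘ (fun x => fderiv ℝ (fun θ => F (x, θ)) θ) := by
        ext1 y
        simp only [Function.comp_apply, ContinuousLinearMap.apply_apply,
          (hasFDerivAt_slice_right hd y θ).fderiv]
        simp
      have hc2 : ContDiff ℝ (n : ℕ∞) (fun x => fderiv ℝ (fun θ => F (x, θ)) θ) :=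
        hslice.comp (contDiff_id.prodMk contDiff_const)
      rw [e2, e3, e4, ContinuousLinearMap.iteratedFDeriv_comp_left _ hc2.contDiffAt le_rfl]
      rfl
    rw [e1]
    calc _ ≤ ‖iteratedFDeriv ℝ n (fun x => fderiv ℝ (fun θ => F (x, θ)) θ) x w‖ * ‖v‖ :=
          ContinuousLinearMap.le_opNorm _ _
      _ ≤ _ := by
        gcongr
        exact (ContinuousMultilinearMap.le_opNorm _ _).trans (by gcongr; exact hL θ hθ)
  have := hs.norm_image_sub_le_of_norm_hasFDerivWithin_le
    (fun θ _ => (hφ θ).hasFDerivWithinAt) hbound hθ hθ'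
  rw [sub_apply, hval, hval]
  calc _ ≤ _ := this
    _ = _ := by ring

/-- Second-difference bound for the derivatives in the first variable. -/
lemma norm_iteratedFDeriv_slice_second_diff_le {F : E × G → H} {n : ℕ}
    (hF : ContDiff ℝ ((n + 2 : ℕ) : ℕ∞) F) {t : Set E} (ht : Convex ℝ t) {s : Set G}
    (hs : Convex ℝ s) {L : ℝ}
    (hL : ∀ x ∈ t, ∀ θ ∈ s,
      ‖iteratedFDeriv ℝ (n + 1) (fun x => fderiv ℝ (fun θ => F (x, θ)) θ) x‖ ≤ L)
    {θ θ' : G} (hθ : θ ∈ s) (hθ' : θ' ∈ s) {x x' : E} (hx : x ∈ t) (hx' : x' ∈ t) :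
    ‖(iteratedFDeriv ℝ n (fun y => F (y, θ')) x' - iteratedFDeriv ℝ n (fun y => F (y, θ)) x')
      - (iteratedFDeriv ℝ n (fun y => F (y, θ')) x - iteratedFDeriv ℝ n (fun y => F (y, θ)) x)‖
      ≤ L * ‖θ' - θ‖ * ‖x' - x‖ := by
  have hd : ∀ θ, Differentiable ℝ (iteratedFDeriv ℝ n (fun y => F (y, θ))) := by
    intro θ
    have : ContDiff ℝ ((n + 2 : ℕ) : ℕ∞) (fun y => F (y, θ)) :=
      hF.comp (contDiff_id.prodMk contDiff_const)
    exact this.differentiable_iteratedFDeriv (by norm_cast; omega)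
  refine ht.norm_image_sub_le_of_norm_hasFDerivWithin_le
    (f := fun x => iteratedFDeriv ℝ n (fun y => F (y, θ')) x -
      iteratedFDeriv ℝ n (fun y => F (y, θ)) x)
    (fun x _ => ((hd θ' x).hasFDerivAt.sub (hd θ x).hasFDerivAt).hasFDerivWithinAt)
    (fun x hx => ?_) hx hx'
  have h1 := norm_iteratedFDeriv_slice_sub_le (n := n + 1) hF hs (hL x hx) hθ hθ'
  have hc : ∀ θ, ContDiff ℝ ((n + 2 : ℕ) : ℕ∞) (fun y => F (y, θ)) := fun θ =>
    hF.comp (contDiff_id.prodMk contDiff_const)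
  have h2 : ∀ k : ℕ, k ≤ n + 1 → iteratedFDeriv ℝ k (fun y => F (y, θ') - F (y, θ)) =
      fun x => iteratedFDeriv ℝ k (fun y => F (y, θ')) x - iteratedFDeriv ℝ k (fun y => F (y, θ)) x :=
    fun k hk => by
      have hk' : ∀ θ, ContDiff ℝ (k : ℕ∞) (fun y => F (y, θ)) := fun θ =>
        (hc θ).of_le (by exact_mod_cast (by omega : k ≤ n + 2))
      ext1 x
      exact iteratedFDeriv_sub_apply (hk' θ').contDiffAt (hk' θ).contDiffAt
  have h3 := norm_fderiv_iteratedFDeriv (𝕜 := ℝ) (f := fun y => F (y, θ') - F (y, θ)) (x := x)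
    (n := n)
  rw [h2 n (by omega), h2 (n + 1) le_rfl] at h3
  rw [← h3, fderiv_fun_sub (hd θ' x) (hd θ x)] at h1
  exact h1

end Calculus

/-! ### Nets of balls in finite dimension -/

section Covering

variable {E : Type*} [NormedAddCommGroup E] [NormedSpace ℝ E] [FiniteDimensional ℝ E]

open Module in
-- Volume comparison: the balls of radius `r / 2` around the points are disjoint and lie in the ball
-- of radius `R + r / 2`.
lemma card_le_of_separated_closedBall {R r : ℝ} (hR : 0 ≤ R) (hr : 0 < r) {s : Finset E}
    (hs : ∀ c ∈ s, ‖c‖ ≤ R) (h : ∀ c ∈ s, ∀ d ∈ s, c ≠ d → r < dist c d) :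
    (s.card : ℝ) ≤ (1 + 2 * R / r) ^ finrank ℝ E := by
  borelize E
  let μ : Measure E := Measure.addHaar
  have hr2 : 0 < r / 2 := by positivity
  have hρ : 0 < R + r / 2 := by positivity
  have hdisj : (s : Set E).PairwiseDisjoint (fun c => Metric.ball c (r / 2)) := by
    intro c hc d hd hcd
    apply Metric.ball_disjoint_ball
    have := h c hc d hd hcd
    linarith
  have hsub : (⋃ c ∈ s, Metric.ball c (r / 2)) ⊆ Metric.ball (0 : E) (R + r / 2) := by
    refine iUnion₂_subset fun c hc => Metric.ball_subset_ball' ?_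
    rw [dist_zero_right]
    linarith [hs c hc]
  have I : (s.card : ENNReal) * ENNReal.ofReal ((r / 2) ^ finrank ℝ E) * μ (Metric.ball 0 1) ≤
      ENNReal.ofReal ((R + r / 2) ^ finrank ℝ E) * μ (Metric.ball 0 1) := by
    calc _ = μ (⋃ c ∈ s, Metric.ball c (r / 2)) := by
          rw [measure_biUnion_finset hdisj fun c _ => measurableSet_ball]
          simp only [μ.addHaar_ball_of_pos _ hr2, Finset.sum_const, nsmul_eq_mul, mul_assoc]
      _ ≤ μ (Metric.ball (0 : E) (R + r / 2)) := measure_mono hsub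
      _ = _ := μ.addHaar_ball_of_pos _ hρ
  have J := (ENNReal.mul_le_mul_iff_left (Metric.measure_ball_pos μ _ zero_lt_one).ne'
    measure_ball_lt_top.ne).1 I
  have K : (s.card : ℝ) * (r / 2) ^ finrank ℝ E ≤ (R + r / 2) ^ finrank ℝ E := by
    have := ENNReal.toReal_le_of_le_ofReal (pow_nonneg hρ.le _) J
    rwa [ENNReal.toReal_mul, ENNReal.toReal_natCast, ENNReal.toReal_ofReal (by positivity)] at this
  have e : (1 + 2 * R / r) = (R + r / 2) / (r / 2) := by field_simp; ring
  rw [e, div_pow, le_div_iff₀ (by positivity)]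
  exact K

open Module in
-- An `r`-separated set of maximal cardinality covers, since an uncovered point could be added to
-- it. The centers stay in the ball, where the derivative bounds of the policies hold.
lemma exists_finset_cover_closedBall {R r : ℝ} (hR : 0 ≤ R) (hr : 0 < r) :
    ∃ s : Finset E, (∀ c ∈ s, ‖c‖ ≤ R) ∧ (∀ x : E, ‖x‖ ≤ R → ∃ c ∈ s, dist x c ≤ r) ∧
      (s.card : ℝ) ≤ (1 + 2 * R / r) ^ finrank ℝ E := by
  classical
  let P : ℕ → Prop := fun k => ∃ s : Finset E, s.card = k ∧ (∀ c ∈ s, ‖c‖ ≤ R) ∧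
    ∀ c ∈ s, ∀ d ∈ s, c ≠ d → r < dist c d
  have hP0 : P 0 := ⟨∅, by simp⟩
  let N := ⌊(1 + 2 * R / r) ^ finrank ℝ E⌋₊
  have hN : ∀ k, P k → k ≤ N := by
    rintro k ⟨s, rfl, h1, h2⟩
    exact Nat.le_floor (card_le_of_separated_closedBall hR hr h1 h2)
  obtain ⟨s, hcard, h1, h2⟩ : P (Nat.findGreatest P N) :=
    Nat.findGreatest_spec (Nat.zero_le N) hP0
  refine ⟨s, h1, fun x hx => ?_, card_le_of_separated_closedBall hR hr h1 h2⟩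
  by_contra! hcon
  have hxs : x ∉ s := fun hx' => by
    have := hcon x hx'
    rw [dist_self] at this
    linarith
  have hP : P (Nat.findGreatest P N + 1) := by
    refine ⟨insert x s, by rw [Finset.card_insert_of_notMem hxs, hcard], ?_, ?_⟩
    · intro c hc
      rcases Finset.mem_insert.1 hc with rfl | hc
      exacts [hx, h1 c hc]
    · intro c hc d hd hcd
      rcases Finset.mem_insert.1 hc with hc | hc' <;> rcases Finset.mem_insert.1 hd with hd | hd'
      · exact absurd (hc.trans hd.symm) hcd
      · exact hc ▸ hcon d hd'
      · rw [dist_comm, hd]; exact hcon c hc'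
      · exact h2 c hc' d hd' hcd
  have := Nat.le_findGreatest (hN _ hP) hP
  omega

end Covering

/-! ### Measurability of the selected parameter cell -/

section Selection

/-- The parameters of a compact set that a function attains on a countable set of points are
chosen measurably. -/
lemma measurableSet_exists_param {S E Θ Y : Type*} [MeasurableSpace S] [TopologicalSpace Θ]
    [TopologicalSpace Y] [T2Space Y] [SecondCountableTopology Y] [MeasurableSpace Y] [BorelSpace Y]
    {pol : E → Θ → Y} (hpol : ∀ x, Continuous (pol x)) {g : S → E → Y}
    (hg : ∀ x, Measurable (fun s => g s x)) {K : Set Θ} (hK : IsCompact K) (u : ℕ → E) :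
    MeasurableSet {s | ∃ θ ∈ K, ∀ i, g s (u i) = pol (u i) θ} := by
  -- The tuples of values attained with parameters in `K` form a compact, hence closed, set in the
  -- countable product; no measurable choice of `θ` is needed.
  have hc : IsCompact ((fun θ => fun i => pol (u i) θ) '' K) :=
    hK.image (continuous_pi fun i => hpol (u i))
  have hm : Measurable (fun s => fun i => g s (u i)) := measurable_pi_lambda _ fun i => hg (u i)
  convert! hm hc.isClosed.measurableSet using 1
  ext s
  simp only [mem_ofPred_eq, mem_preimage, mem_image, funext_iff]
  exact exists_congr fun θ => and_congr_right fun _ => forall_congr' fun i => eq_comm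

end Selection

/-! ### Consistent hypotheses with error sets depending on the first sample -/

section Consistency

variable {Ω ι : Type*} [MeasurableSpace Ω]

/-- With the first sample fixed, the other `n` are independent and each misses a set of mass above
`ρ` with probability at most `1 - ρ ≤ exp (-ρ)`; then Fubini over the first sample. -/
lemma measure_avoid_le (D : Measure Ω) [IsProbabilityMeasure D] (n : ℕ) {A : Set (Ω × Ω)}
    (hA : MeasurableSet A) {ρ : ℝ} (hρ : 0 ≤ ρ) :
    (Measure.pi (fun _ : Fin (n + 1) => D))
      {ξs | ENNReal.ofReal ρ < D (Prod.mk (ξs 0) ⁻¹' A) ∧ ∀ i : Fin n, (ξs 0, ξs i.succ) ∉ A} ≤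
      ENNReal.ofReal (Real.exp (-(ρ * n))) := by
  let s : Set (Ω × (Fin n → Ω)) :=
    {w | ENNReal.ofReal ρ < D (Prod.mk w.1 ⁻¹' A) ∧ ∀ i : Fin n, (w.1, w.2 i) ∉ A}
  have hsec : Measurable (fun a => D (Prod.mk a ⁻¹' A)) := measurable_measure_prodMk_left hA
  have hs : MeasurableSet s := by
    refine MeasurableSet.inter (measurableSet_lt measurable_const (hsec.comp measurable_fst)) ?_
    have : {w : Ω × (Fin n → Ω) | ∀ i : Fin n, (w.1, w.2 i) ∉ A} =
        ⋂ i, (fun w : Ω × (Fin n → Ω) => (w.1, w.2 i)) ⁻¹' Aᶜ := by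
      ext w; simp
    change MeasurableSet {w : Ω × (Fin n → Ω) | ∀ i : Fin n, (w.1, w.2 i) ∉ A}
    rw [this]
    refine MeasurableSet.iInter fun i => ?_
    have : Measurable (fun w : Ω × (Fin n → Ω) => (w.1, w.2 i)) := by fun_prop
    exact this hA.compl
  have hmp := measurePreserving_piFinSuccAbove (fun _ : Fin (n + 1) => D) 0
  have hpre := hmp.measure_preimage hs.nullMeasurableSet
  have heq : (MeasurableEquiv.piFinSuccAbove (fun _ : Fin (n + 1) => Ω) 0) ⁻¹' s =
      {ξs | ENNReal.ofReal ρ < D (Prod.mk (ξs 0) ⁻¹' A) ∧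
        ∀ i : Fin n, (ξs 0, ξs i.succ) ∉ A} := by
    ext ξs
    rfl
  rw [heq] at hpre
  rw [hpre, Measure.prod_apply hs]
  have hexp : ENNReal.ofReal (Real.exp (-(ρ * n))) = ENNReal.ofReal (Real.exp (-ρ)) ^ n := by
    rw [← ENNReal.ofReal_pow (Real.exp_pos _).le, ← Real.exp_nat_mul]
    congr 2
    ring
  calc _ ≤ ∫⁻ _, ENNReal.ofReal (Real.exp (-(ρ * n))) ∂D := by
        refine lintegral_mono fun a => ?_
        by_cases ha : ENNReal.ofReal ρ < D (Prod.mk a ⁻¹' A)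
        · have h1 : Prod.mk a ⁻¹' s ⊆ Set.pi univ (fun _ : Fin n => (Prod.mk a ⁻¹' A)ᶜ) :=
            fun v hv i _ => hv.2 i
          refine (measure_mono h1).trans ?_
          change (Measure.pi fun _ : Fin n => D) _ ≤ _
          rw [Measure.pi_pi, Finset.prod_const, Finset.card_univ, Fintype.card_fin, hexp]
          gcongr
          rw [prob_compl_eq_one_sub (measurable_prodMk_left hA)]
          calc _ ≤ 1 - ENNReal.ofReal ρ := tsub_le_tsub_left ha.le _
            _ = ENNReal.ofReal (1 - ρ) := by rw [ENNReal.ofReal_sub _ hρ, ENNReal.ofReal_one]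
            _ ≤ _ := ENNReal.ofReal_le_ofReal (Real.one_sub_le_exp_neg ρ)
        · have h1 : Prod.mk a ⁻¹' s = ∅ := by
            ext v
            simp only [mem_preimage, mem_empty_iff_false, iff_false]
            exact fun hv => ha hv.1
          rw [h1]
          simp
    _ = _ := by simp

/-- Finitely many hypotheses `k`, with error sets `A k` that may depend on the first sample, and
disjoint events `G k` on which the hypothesis `k` is selected: the selected hypothesis is
unlikely to make no error on the samples and an error on a fresh point. -/
lemma measure_consistent_selection_le (D : Measure Ω) [IsProbabilityMeasure D] (n : ℕ) [Fintype ι]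
    {G : ι → Set (Fin (n + 1) → Ω)} (hG : ∀ k, MeasurableSet (G k)) (hGd : Pairwise (Function.onFun Disjoint G))
    {A : ι → Set (Ω × Ω)} (hA : ∀ k, MeasurableSet (A k)) {ρ : ℝ} (hρ : 0 ≤ ρ) :
    ((Measure.pi (fun _ : Fin (n + 1) => D)).prod D)
      {z | ∃ k, z.1 ∈ G k ∧ (∀ i : Fin n, (z.1 0, z.1 i.succ) ∉ A k) ∧ (z.1 0, z.2) ∈ A k} ≤
      ENNReal.ofReal ρ + Fintype.card ι * ENNReal.ofReal (Real.exp (-(ρ * n))) := by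
  let good : Set ((Fin (n + 1) → Ω) × Ω) :=
    ⋃ k, {z | z.1 ∈ G k ∧ D (Prod.mk (z.1 0) ⁻¹' A k) ≤ ENNReal.ofReal ρ ∧ (z.1 0, z.2) ∈ A k}
  let bad : ι → Set (Fin (n + 1) → Ω) := fun k =>
    {ξs | ENNReal.ofReal ρ < D (Prod.mk (ξs 0) ⁻¹' A k) ∧ ∀ i : Fin n, (ξs 0, ξs i.succ) ∉ A k}
  have hsub : {z : (Fin (n + 1) → Ω) × Ω | ∃ k, z.1 ∈ G k ∧
      (∀ i : Fin n, (z.1 0, z.1 i.succ) ∉ A k) ∧ (z.1 0, z.2) ∈ A k} ⊆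
      good ∪ ⋃ k, (bad k) ×ˢ univ := by
    rintro z ⟨k, h1, h2, h3⟩
    by_cases hk : D (Prod.mk (z.1 0) ⁻¹' A k) ≤ ENNReal.ofReal ρ
    · exact Or.inl (mem_iUnion.2 ⟨k, h1, hk, h3⟩)
    · exact Or.inr (mem_iUnion.2 ⟨k, ⟨not_le.1 hk, h2⟩, mem_univ _⟩)
  have hgoodm : MeasurableSet good := by
    refine MeasurableSet.iUnion fun k => ?_
    refine MeasurableSet.inter (measurable_fst (hG k)) (MeasurableSet.inter ?_ ?_)
    · have h1 : Measurable (fun z : (Fin (n + 1) → Ω) × Ω => D (Prod.mk (z.1 0) ⁻¹' A k)) :=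
        (measurable_measure_prodMk_left (hA k)).comp ((measurable_pi_apply 0).comp measurable_fst)
      exact measurableSet_le h1 measurable_const
    · have h1 : Measurable (fun z : (Fin (n + 1) → Ω) × Ω => (z.1 0, z.2)) := by fun_prop
      exact h1 (hA k)
  have hgood : ((Measure.pi (fun _ : Fin (n + 1) => D)).prod D) good ≤ ENNReal.ofReal ρ := by
    rw [Measure.prod_apply hgoodm]
    calc _ ≤ ∫⁻ _, ENNReal.ofReal ρ ∂(Measure.pi (fun _ : Fin (n + 1) => D)) := by
          refine lintegral_mono fun ξs => ?_
          -- Disjointness leaves at most one selected `k` per sample, so this part costs `ρ` once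
          -- instead of once per hypothesis.
          by_cases h : ∃ k, ξs ∈ G k ∧ D (Prod.mk (ξs 0) ⁻¹' A k) ≤ ENNReal.ofReal ρ
          · obtain ⟨k, hk, hk'⟩ := h
            refine (measure_mono ?_).trans hk'
            intro ξ hξ
            obtain ⟨l, hl, -, hl'⟩ := mem_iUnion.1 hξ
            by_cases hkl : k = l
            · subst hkl; exact hl'
            · exact absurd hl (disjoint_left.1 (hGd hkl) hk)
          · have : Prod.mk ξs ⁻¹' good = ∅ := by
              ext ξ
              simp only [mem_preimage, mem_empty_iff_false, iff_false]
              intro hξ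
              obtain ⟨l, hl, hl', -⟩ := mem_iUnion.1 hξ
              exact h ⟨l, hl, hl'⟩
            rw [this]
            simp
      _ = _ := by simp
  refine (measure_mono hsub).trans ((measure_union_le _ _).trans (add_le_add hgood ?_))
  refine (measure_iUnion_fintype_le _ _).trans ?_
  calc _ ≤ ∑ _k : ι, ENNReal.ofReal (Real.exp (-(ρ * n))) := by
        refine Finset.sum_le_sum fun k _ => ?_
        rw [Measure.prod_prod, measure_univ, mul_one]
        exact measure_avoid_le D n (hA k) hρ
    _ = _ := by simp

end Consistency

/-! ### From derivative errors to the imitation gap -/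

section Stability

variable {d m p T : ℕ}

/-- The value of a class `K` function at an argument is bounded by `x` as soon as the
argument is bounded by the inverse of the function at `x`. -/
lemma IsClassK.apply_le_of_le_inverse {γ : ℝ → ℝ} (hγ : IsClassK γ) {x Y : ℝ} (hx : 0 ≤ x)
    (hY : 0 ≤ Y) (h : ∀ y, 0 ≤ y → γ y = x → Y ≤ y) : γ Y ≤ x := by
  by_contra! hlt
  obtain ⟨y, hy, hyx⟩ := intermediate_value_Icc hY (hγ.continuousOn.mono Icc_subset_Ici_self)
    (show x ∈ Icc (γ 0) (γ Y) from ⟨by rwa [hγ.map_zero], hlt.le⟩)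
  have := h y hy.1 hyx
  rw [le_antisymm this hy.2] at hlt
  exact hlt.ne hyx.symm

/-- The factor `j!` in the hypothesis cancels the Taylor coefficient, and `ε ≤ 1 / 2` leaves a
geometric series with sum at most `2`. Each function contributes one remainder, whence the factor
`2`. -/
lemma norm_sub_le_of_taylor {g g' : Euc d → Euc m} {Lp : ℝ} (hg : HasTaylorBound p Lp g)
    (hg' : HasTaylorBound p Lp g') {x x₀ : Euc d} {S ε : ℝ} (hS : 0 ≤ S) (hε : ε ≤ 1 / 2)
    (hLp : 0 ≤ Lp) (hx : ‖x - x₀‖ ≤ ε)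
    (hd : ∀ j ≤ p, ‖iteratedFDeriv ℝ j (fun x => g x - g' x) x₀‖ ≤ j.factorial * (S / 2)) :
    ‖g x - g' x‖ ≤ S + 2 * (Lp / ((p + 1).factorial : ℝ)) * ε ^ (p + 1) := by
  have hdiff : taylorPoly p g x₀ x - taylorPoly p g' x₀ x =
      ∑ j ∈ Finset.range (p + 1), (1 / (j.factorial : ℝ)) •
        iteratedFDeriv ℝ j (fun x => g x - g' x) x₀ (fun _ => x - x₀) := by
    unfold taylorPoly
    rw [← Finset.sum_sub_distrib]
    refine Finset.sum_congr rfl fun j hj => ?_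
    have hjp : (j : ℕ∞) ≤ p := by exact_mod_cast Nat.lt_succ_iff.1 (Finset.mem_range.1 hj)
    have hc : ∀ g : Euc d → Euc m, HasTaylorBound p Lp g → ContDiff ℝ (j : ℕ∞) g := fun g hg =>
      hg.1.of_le (by exact_mod_cast hjp)
    rw [fun_iteratedFDeriv_sub_apply (hc g hg).contDiffAt (hc g' hg').contDiffAt, sub_apply,
      smul_sub]
  have hx0 : 0 ≤ ‖x - x₀‖ := norm_nonneg _
  have hsum : ‖taylorPoly p g x₀ x - taylorPoly p g' x₀ x‖ ≤ S := by
    rw [hdiff]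
    calc _ ≤ ∑ j ∈ Finset.range (p + 1), S / 2 * (1 / 2) ^ j := by
          refine norm_sum_le_of_le _ fun j hj => ?_
          have hjp : j ≤ p := Nat.lt_succ_iff.1 (Finset.mem_range.1 hj)
          rw [norm_smul, Real.norm_of_nonneg (by positivity)]
          calc _ ≤ 1 / (j.factorial : ℝ) * (j.factorial * (S / 2) * (1 / 2) ^ j) := by
                gcongr
                refine (ContinuousMultilinearMap.le_opNorm _ _).trans ?_
                rw [Finset.prod_const, Finset.card_univ, Fintype.card_fin]
                gcongr
                · exact hd j hjp
                · exact hx.trans hε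
            _ = _ := by field_simp
      _ = S / 2 * ∑ j ∈ Finset.range (p + 1), (1 / 2 : ℝ) ^ j := by rw [Finset.mul_sum]
      _ ≤ S / 2 * 2 := by
        gcongr
        exact sum_geometric_two_le _
      _ = S := by ring
  have hrem : ∀ g : Euc d → Euc m, HasTaylorBound p Lp g →
      ‖g x - taylorPoly p g x₀ x‖ ≤ Lp / ((p + 1).factorial : ℝ) * ε ^ (p + 1) := fun g hg =>
    (hg.2 x x₀).trans (by gcongr)
  calc ‖g x - g' x‖ = ‖(taylorPoly p g x₀ x - taylorPoly p g' x₀ x) +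
        ((g x - taylorPoly p g x₀ x) - (g' x - taylorPoly p g' x₀ x))‖ := by congr 1; abel
    _ ≤ ‖taylorPoly p g x₀ x - taylorPoly p g' x₀ x‖ +
        (‖g x - taylorPoly p g x₀ x‖ + ‖g' x - taylorPoly p g' x₀ x‖) :=
      (norm_add_le _ _).trans (by gcongr; exact norm_sub_le _ _)
    _ ≤ S + (Lp / ((p + 1).factorial : ℝ) * ε ^ (p + 1) +
        Lp / ((p + 1).factorial : ℝ) * ε ^ (p + 1)) :=
      add_le_add hsum (add_le_add (hrem g hg) (hrem g' hg'))
    _ = _ := by ring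

/-- Incremental stability of the expert turns small derivative errors along the expert trajectory
into a small imitation gap. -/
lemma imitationGap_le {f : Euc d → Euc m → Euc d} {X : Set (Euc d)} {polStar polHat : Euc d → Euc m}
    {η r Lp μ α S : ℝ} {γ : ℝ → ℝ} (hT : 1 ≤ T) (hr : 1 ≤ r)
    (hstab : IsLocallyDISS f X polStar η γ) (hLp : 0 ≤ Lp) (hstar : HasTaylorBound p Lp polStar)
    (hhat : HasTaylorBound p Lp polHat) (hμ : 0 < μ) (hα : α ≤ 1 / 2)
    (hnbhd : NeighborhoodRelation p Lp r μ α γ) {ξ : Euc d} (hξ : ξ ∈ X) (hS : 0 ≤ S)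
    (hd : ∀ j ≤ p, ∀ t < T,
      ‖iteratedFDeriv ℝ j (fun x => polHat x - polStar x) (traj f polStar ξ t)‖ ≤
        j.factorial * (S / 2))
    (hSα : μ * S ^ (1 / r) ≤ α)
    (hSη : S + 2 * (Lp / ((p + 1).factorial : ℝ)) * (μ * S ^ (1 / r)) ^ (p + 1) ≤ η) :
    imitationGap f polStar polHat T ξ ≤ μ * S ^ (1 / r) := by
  obtain ⟨hγ, β, hβ, hiss⟩ := hstab
  set ε := μ * S ^ (1 / r) with hε
  have hε0 : 0 ≤ ε := by positivity
  set Y := S + 2 * (Lp / ((p + 1).factorial : ℝ)) * ε ^ (p + 1) with hY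
  have hY0 : 0 ≤ Y := by positivity
  have hεS : (ε / μ) ^ r = S := by
    rw [hε, mul_div_cancel_left₀ _ hμ.ne', ← Real.rpow_mul hS,
      one_div_mul_cancel (by positivity), Real.rpow_one]
  have hγY : γ Y ≤ ε := by
    refine hγ.apply_le_of_le_inverse hε0 hY0 fun y hy hyε => ?_
    have := hnbhd ε hε0 hSα y hy hyε
    rw [hεS] at this
    linarith
  have key : ∀ t ≤ T, ‖traj f polHat ξ t - traj f polStar ξ t‖ ≤ ε := by
    intro t
    induction t using Nat.strong_induction_on with
    | _ t ih =>
      intro htT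
      -- Up to time `t`, the learned loop is the expert loop perturbed by the policy error along the
      -- learned states. Stability needs `‖Δ s‖ ≤ η` at all times while the induction hypothesis
      -- covers only `s < t`, hence the cut-off.
      let Δ : ℕ → Euc m := fun s =>
        if s < t then polHat (traj f polHat ξ s) - polStar (traj f polHat ξ s) else 0
      have htraj : ∀ s ≤ t, perturbedTraj f polStar Δ ξ s = traj f polHat ξ s := by
        intro s hs
        induction s with
        | zero => rfl
        | succ s ihs =>
          have h1 := ihs (Nat.le_of_succ_le hs)
          have h2 : Δ s = polHat (traj f polHat ξ s) - polStar (traj f polHat ξ s) :=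
            if_pos (Nat.lt_of_succ_le hs)
          have h3 : traj f polHat ξ (s + 1) =
              f (traj f polHat ξ s) (polHat (traj f polHat ξ s) + 0) := rfl
          rw [h3, perturbedTraj, h1, h2]
          congr 1
          abel
      have hΔ : ∀ s, ‖Δ s‖ ≤ Y := by
        intro s
        by_cases hs : s < t
        · have h2 : Δ s = polHat (traj f polHat ξ s) - polStar (traj f polHat ξ s) := if_pos hs
          rw [h2]
          exact norm_sub_le_of_taylor hhat hstar hS (hSα.trans hα) hLp
            (ih s hs (hs.le.trans htT)) fun j hj => hd j hj s (hs.trans_le htT)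
        · have h2 : Δ s = 0 := if_neg hs
          rw [h2, norm_zero]
          exact hY0
      have h1 := hiss ξ hξ ξ hξ Δ (fun s => (hΔ s).trans hSη) t
      rw [htraj t le_rfl, sub_self, norm_zero, (hβ.classK t (Nat.cast_nonneg t)).map_zero,
        zero_add] at h1
      refine h1.trans (le_trans ?_ hγY)
      exact hγ.strictMonoOn.monotoneOn (Real.iSup_nonneg fun _ => norm_nonneg _) hY0
        (Real.iSup_le (fun k => hΔ k) hY0)
  have : Nonempty (Fin T) := ⟨⟨0, hT⟩⟩
  exact ciSup_le fun t => key (t + 1) t.2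

/-- The imitation gap in terms of bounds on the derivative errors of each order. -/
lemma imitationGap_le_iSup {f : Euc d → Euc m → Euc d} {X : Set (Euc d)}
    {polStar polHat : Euc d → Euc m}
    {η r Lp μ α : ℝ} {γ : ℝ → ℝ} (hT : 1 ≤ T) (hr : 1 ≤ r) (hpr : 0 < (p : ℝ) + 1 - r)
    (hstab : IsLocallyDISS f X polStar η γ) (hLp : 0 ≤ Lp) (hstar : HasTaylorBound p Lp polStar)
    (hhat : HasTaylorBound p Lp polHat) (hμ : 0 < μ) (hα0 : 0 < α) (hα : α ≤ 1 / 2)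
    (hnbhd : NeighborhoodRelation p Lp r μ α γ) (hαp : (α / μ) ^ r * (p.factorial : ℝ) ≤ 2)
    {ξ : Euc d} (hξ : ξ ∈ X) {M : ℕ → ℝ} (hM0 : ∀ j ≤ p, 0 ≤ M j)
    (hd : ∀ j ≤ p, ∀ t < T,
      ‖iteratedFDeriv ℝ j (fun x => polHat x - polStar x) (traj f polStar ξ t)‖ ≤ M j)
    (hMα : ∀ j ≤ p, M j ≤ j.factorial * (α / μ) ^ r / 4)
    (hMη : ∀ j ≤ p, M j * (Lp / ((p + 1).factorial : ℝ) *
      (μ ^ (p + 1) / (j.factorial : ℝ) ^ (((p : ℝ) + 1) / r)) + 1 / (j.factorial : ℝ)) ≤ η / 4) :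
    ∃ j : Fin (p + 1),
      imitationGap f polStar polHat T ξ ≤ μ * (2 * M j / (j : ℕ).factorial) ^ (1 / r) := by
  -- The worst order supplies `S = 2 M i / i!`.
  obtain ⟨i, hi⟩ := Finite.exists_max (fun j : Fin (p + 1) => 2 * M j / (j : ℕ).factorial)
  have hip : (i : ℕ) ≤ p := Nat.lt_succ_iff.1 i.2
  have hfac : (0 : ℝ) < (i : ℕ).factorial := by exact_mod_cast Nat.factorial_pos _
  have hMi := hM0 i hip
  have hr0 : 0 < r := by positivity
  refine ⟨i, imitationGap_le hT hr hstab hLp hstar hhat hμ hα hnbhd hξ (by positivity) ?_ ?_ ?_⟩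
  · intro j hj t ht
    refine (hd j hj t ht).trans ?_
    have h1 := hi ⟨j, Nat.lt_succ_iff.2 hj⟩
    have hj0 : (0 : ℝ) < j.factorial := by exact_mod_cast Nat.factorial_pos _
    simp only at h1
    rw [div_le_iff₀ hj0] at h1
    linarith
  · have h1 : 2 * M i / (i : ℕ).factorial ≤ (α / μ) ^ r := by
      rw [div_le_iff₀ hfac]
      have := hMα i hip
      have : 0 ≤ (i : ℕ).factorial * (α / μ) ^ r := by positivity
      linarith
    calc μ * (2 * M i / (i : ℕ).factorial) ^ (1 / r) ≤ μ * ((α / μ) ^ r) ^ (1 / r) := by gcongr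
      _ = α := by
        rw [← Real.rpow_mul (by positivity), mul_one_div_cancel hr0.ne', Real.rpow_one]
        field_simp
  -- As `2 M i ≤ 1` and `(p+1)/r ≥ 1`, the power `(2 M i)^((p+1)/r)` is at most `2 M i`, so a
  -- condition linear in `M i` suffices for the bound by `η`.
  · have hM1 : 2 * M i ≤ 1 := by
      have h1 := hMα i hip
      have h2 : ((i : ℕ).factorial : ℝ) ≤ p.factorial := by exact_mod_cast Nat.factorial_le hip
      have h3 : ((i : ℕ).factorial : ℝ) * (α / μ) ^ r ≤ p.factorial * (α / μ) ^ r := by gcongr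
      linarith
    have hpow : ((2 * M i / (i : ℕ).factorial) ^ (1 / r)) ^ (p + 1) ≤
        2 * M i / ((i : ℕ).factorial : ℝ) ^ (((p : ℝ) + 1) / r) := by
      rw [← Real.rpow_natCast, ← Real.rpow_mul (by positivity)]
      have e : 1 / r * ((p + 1 : ℕ) : ℝ) = ((p : ℝ) + 1) / r := by push_cast; ring
      rw [e, Real.div_rpow (by positivity) hfac.le]
      gcongr
      have h1 : 1 ≤ ((p : ℝ) + 1) / r := by
        rw [le_div_iff₀ hr0]
        linarith
      calc (2 * M i) ^ (((p : ℝ) + 1) / r) ≤ (2 * M i) ^ (1 : ℝ) :=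
            Real.rpow_le_rpow_of_exponent_ge' (by positivity) hM1 zero_le_one h1
        _ = 2 * M i := Real.rpow_one _
    have h1 := hMη i hip
    rw [mul_pow]
    calc _ ≤ 2 * M i / (i : ℕ).factorial + 2 * (Lp / ((p + 1).factorial : ℝ)) * (μ ^ (p + 1) *
          (2 * M i / ((i : ℕ).factorial : ℝ) ^ (((p : ℝ) + 1) / r))) := by gcongr
      _ ≤ 4 * (M i * (Lp / ((p + 1).factorial : ℝ) * (μ ^ (p + 1) /
          ((i : ℕ).factorial : ℝ) ^ (((p : ℝ) + 1) / r)) + 1 / ((i : ℕ).factorial : ℝ))) := by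
        have : 0 ≤ M i / (i : ℕ).factorial := by positivity
        have e : 4 * (M i * (Lp / ((p + 1).factorial : ℝ) * (μ ^ (p + 1) /
          ((i : ℕ).factorial : ℝ) ^ (((p : ℝ) + 1) / r)) + 1 / ((i : ℕ).factorial : ℝ))) -
          (2 * M i / (i : ℕ).factorial + 2 * (Lp / ((p + 1).factorial : ℝ)) * (μ ^ (p + 1) *
          (2 * M i / ((i : ℕ).factorial : ℝ) ^ (((p : ℝ) + 1) / r)))) =
          2 * (M i / (i : ℕ).factorial) := by ring
        linarith
      _ ≤ η := by linarith

end Stability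

/-! ### Derivative bounds, zero training error and measurability -/

section PolicyFamily

variable {d m q p T n : ℕ} {pol : Euc d → Euc q → Euc m} {BX Bθ : ℝ}

lemma IsPolicyFamily.contDiff_policy (hpol : IsPolicyFamily p pol) (θ : Euc q) :
    ContDiff ℝ ((p + 2 : ℕ) : ℕ∞) (fun x => pol x θ) :=
  hpol.contDiff.comp (contDiff_id.prodMk contDiff_const)

lemma IsPolicyFamily.norm_iteratedFDeriv_le (hpol : IsPolicyFamily p pol) {j : ℕ} (hj : j ≤ p)
    {x : Euc d} {θ : Euc q} (hx : ‖x‖ ≤ BX) (hθ : ‖θ‖ ≤ Bθ) :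
    ‖iteratedFDeriv ℝ j (fun x => pol x θ) x‖ ≤ derivBound pol BX Bθ j := by
  have hc := continuous_iteratedFDeriv_slice hpol.contDiff (i := j)
    (by exact_mod_cast (by omega : j ≤ p + 2))
  have hK : IsCompact (Metric.closedBall (0 : Euc d) BX ×ˢ Metric.closedBall (0 : Euc q) Bθ) :=
    (isCompact_closedBall _ _).prod (isCompact_closedBall _ _)
  exact le_csSup (hK.bddAbove_image hc.norm.continuousOn)
    ⟨(x, θ), ⟨mem_closedBall_zero_iff.2 hx, mem_closedBall_zero_iff.2 hθ⟩, rfl⟩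

lemma IsPolicyFamily.norm_mixed_le (hpol : IsPolicyFamily p pol) {j : ℕ} (hj : j ≤ p)
    {x : Euc d} {θ : Euc q} (hx : ‖x‖ ≤ BX) (hθ : ‖θ‖ ≤ Bθ) :
    ‖iteratedFDeriv ℝ (j + 1) (fun x => fderiv ℝ (fun θ => pol x θ) θ) x‖ ≤
      mixedDerivBound pol BX Bθ j := by
  have hF : ContDiff ℝ ((p + 1 + 1 : ℕ) : ℕ∞) (fun z : Euc d × Euc q => pol z.1 z.2) :=
    hpol.contDiff
  have hc := continuous_iteratedFDeriv_slice (contDiff_fderiv_slice_right hF) (i := j + 1)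
    (by exact_mod_cast (by omega : j + 1 ≤ p + 1))
  have hK : IsCompact (Metric.closedBall (0 : Euc d) BX ×ˢ Metric.closedBall (0 : Euc q) Bθ) :=
    (isCompact_closedBall _ _).prod (isCompact_closedBall _ _)
  exact le_csSup (hK.bddAbove_image hc.norm.continuousOn)
    ⟨(x, θ), ⟨mem_closedBall_zero_iff.2 hx, mem_closedBall_zero_iff.2 hθ⟩, rfl⟩

lemma IsPolicyFamily.iteratedFDeriv_sub (hpol : IsPolicyFamily p pol) {j : ℕ} (hj : j ≤ p)
    (θ θ' : Euc q) (x : Euc d) :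
    iteratedFDeriv ℝ j (fun x => pol x θ - pol x θ') x =
      iteratedFDeriv ℝ j (fun x => pol x θ) x - iteratedFDeriv ℝ j (fun x => pol x θ') x := by
  have hc : ∀ θ, ContDiff ℝ (j : ℕ∞) (fun x => pol x θ) := fun θ =>
    (hpol.contDiff_policy θ).of_le (by exact_mod_cast (by omega : j ≤ p + 2))
  exact fun_iteratedFDeriv_sub_apply (hc θ).contDiffAt (hc θ').contDiffAt

lemma tasilLoss_nonneg (f : Euc d → Euc m → Euc d) (polStar pol : Euc d → Euc m) (p T : ℕ)
    (ξ : Euc d) : 0 ≤ tasilLoss f polStar p T ξ pol := by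
  unfold tasilLoss
  exact mul_nonneg (by positivity)
    (Finset.sum_nonneg fun j _ => Real.iSup_nonneg fun _ => norm_nonneg _)

lemma tasilLoss_self (f : Euc d → Euc m → Euc d) (polStar : Euc d → Euc m) (p T : ℕ)
    (ξ : Euc d) : tasilLoss f polStar p T ξ polStar = 0 := by
  unfold tasilLoss
  simp [iteratedFDeriv_fun_zero]

/-- An empirical risk minimizer over a class that contains the expert matches the derivatives of
the expert along all sampled expert trajectories. -/
lemma IsERM.iteratedFDeriv_eq_zero {f : Euc d → Euc m → Euc d} {polStar polHat : Euc d → Euc m}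
    {P : Set (Euc d → Euc m)} {ξs : Fin n → Euc d} (hstar : polStar ∈ P) (hn : 1 ≤ n)
    (h : IsERM f polStar p T P ξs polHat) (i : Fin n) {j : ℕ} (hj : j ≤ p) {t : ℕ} (ht : t < T) :
    iteratedFDeriv ℝ j (fun x => polHat x - polStar x) (traj f polStar (ξs i) t) = 0 := by
  have h1 := h.2 polStar hstar
  have h2 : empiricalRisk f polStar p T ξs polStar = 0 := by
    simp [empiricalRisk, tasilLoss_self]
  rw [h2] at h1
  unfold empiricalRisk at h1
  have hn0 : (0 : ℝ) < 1 / n := by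
    have : (0 : ℝ) < n := by exact_mod_cast hn
    positivity
  have h3 : ∑ i, tasilLoss f polStar p T (ξs i) polHat ≤ 0 := by
    by_contra! hc
    exact absurd h1 (not_le.2 (mul_pos hn0 hc))
  have h4 : tasilLoss f polStar p T (ξs i) polHat ≤ 0 :=
    (Finset.single_le_sum (f := fun i => tasilLoss f polStar p T (ξs i) polHat)
      (fun i _ => tasilLoss_nonneg _ _ _ _ _ _) (Finset.mem_univ i)).trans h3
  unfold tasilLoss at h4
  have hp0 : (0 : ℝ) < 1 / ((p : ℝ) + 1) := by positivity
  have h5 : ∑ j ∈ Finset.range (p + 1), ⨆ t : Fin T,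
      ‖iteratedFDeriv ℝ j (fun x => polHat x - polStar x) (traj f polStar (ξs i) t)‖ ≤ 0 := by
    by_contra! hc
    exact absurd h4 (not_le.2 (mul_pos hp0 hc))
  have h6 := (Finset.single_le_sum (f := fun j => ⨆ t : Fin T,
      ‖iteratedFDeriv ℝ j (fun x => polHat x - polStar x) (traj f polStar (ξs i) t)‖)
      (fun j _ => Real.iSup_nonneg fun _ => norm_nonneg _)
      (Finset.mem_range.2 (Nat.lt_succ_iff.2 hj))).trans h5
  have h7 := (le_ciSup (f := fun t : Fin T =>
    ‖iteratedFDeriv ℝ j (fun x => polHat x - polStar x) (traj f polStar (ξs i) t)‖)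
    (Set.finite_range _).bddAbove ⟨t, ht⟩).trans h6
  exact norm_le_zero_iff.1 h7

lemma measurable_traj {f : Euc d → Euc m → Euc d}
    (hf : Measurable (fun z : Euc d × Euc m => f z.1 z.2)) {polStar : Euc d → Euc m}
    (hstar : Measurable polStar) (t : ℕ) : Measurable (fun ξ => traj f polStar ξ t) := by
  induction t with
  | zero => exact measurable_id
  | succ t ih =>
    exact hf.comp (ih.prodMk ((hstar.comp ih).add measurable_const))

lemma measurableSet_exists_dist_gt {V : Type*} [NormedAddCommGroup V] {g : Euc d → V}
    (hg : Continuous g) {x : Euc d → ℕ → Euc d} (hx : ∀ t, Measurable (fun ξ => x ξ t)) (T : ℕ)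
    (c : ℝ) : MeasurableSet {w : Euc d × Euc d | ∃ t < T, c < ‖g (x w.2 t) - g w.1‖} := by
  have : {w : Euc d × Euc d | ∃ t < T, c < ‖g (x w.2 t) - g w.1‖} =
      ⋃ t ∈ Finset.range T, {w | c < ‖g (x w.2 t) - g w.1‖} := by
    ext w; simp
  rw [this]
  refine Finset.measurableSet_biUnion _ fun t _ => measurableSet_lt measurable_const ?_
  have hφ : Continuous (fun w : Euc d × Euc d => ‖g w.2 - g w.1‖) := by fun_prop
  exact hφ.measurable.comp (measurable_fst.prodMk ((hx t).comp measurable_snd))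

end PolicyFamily

/-! ### Derivative errors on a fresh trajectory -/

section Generalization

variable {d m q p T n : ℕ} {pol : Euc d → Euc q → Euc m} {BX Bθ : ℝ}

/-- The `j`-th derivative of the learned policy is unlikely to deviate by more than `ε` from the
`j`-th derivative of the expert along a fresh expert trajectory. -/
lemma measure_derivError_le (hpol : IsPolicyFamily p pol) {f : Euc d → Euc m → Euc d}
    (hf : Measurable (fun z : Euc d × Euc m => f z.1 z.2)) {X : Set (Euc d)}
    (D : Measure (Euc d)) [IsProbabilityMeasure D] {polStar : Euc d → Euc m}
    (hstar : polStar ∈ policyClass pol Bθ) (hBX : 0 < BX)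
    (htraj : ∀ ξ ∈ X, ∀ t : ℕ, ‖traj f polStar ξ t‖ ≤ BX) (hT : 1 ≤ T)
    {polHat : (Fin (n + 1) → Euc d) → Euc d → Euc m}
    (hhat : Measurable (fun z : (Fin (n + 1) → Euc d) × Euc d => polHat z.1 z.2))
    (herm : ∀ ξs : Fin (n + 1) → Euc d, (∀ i, ξs i ∈ X) →
      IsERM f polStar p T (policyClass pol Bθ) ξs (polHat ξs))
    {j : ℕ} (hj : j ≤ p) {L : ℝ} (hL0 : 0 < L) (hL : mixedDerivBound pol BX Bθ j ≤ L)
    {ε ρ : ℝ} (hε : 0 < ε) (hρ : 0 ≤ ρ) :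
    ((Measure.pi (fun _ : Fin (n + 1) => D)).prod D)
      {z | (∀ i, z.1 i ∈ X) ∧ z.2 ∈ X ∧ ∃ t < T, ε <
        ‖iteratedFDeriv ℝ j (fun x => polHat z.1 x - polStar x) (traj f polStar z.2 t)‖} ≤
      ENNReal.ofReal (ρ + (1 + 8 * (Bθ * BX * L / ε)) ^ q * Real.exp (-(ρ * n))) := by
  obtain ⟨θs, hθs, hstar_eq⟩ := hstar
  have hBθ : 0 ≤ Bθ := (norm_nonneg _).trans hθs
  have hstarP : polStar ∈ policyClass pol Bθ := ⟨θs, hθs, hstar_eq⟩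
  -- The spacing for which moving to the nearest net point costs `L * r * (2 * BX) = ε / 2`.
  set r := ε / (4 * BX * L) with hr
  have hr0 : 0 < r := by positivity
  obtain ⟨s, hsball, hscov, hscard⟩ := exists_finset_cover_closedBall (E := Euc q) hBθ hr0
  let θ : Fin s.card → Euc q := fun k => (s.equivFin.symm k : Euc q)
  let u : ℕ → Euc d := TopologicalSpace.denseSeq (Euc d)
  let K : Fin s.card → Set (Euc q) := fun k =>
    Metric.closedBall (θ k) r ∩ Metric.closedBall 0 Bθ
  let G₀ : Fin s.card → Set (Fin (n + 1) → Euc d) := fun k =>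
    {ξs | ∃ θ ∈ K k, ∀ i, polHat ξs (u i) = pol (u i) θ}
  have hpolc : Continuous (fun z : Euc d × Euc q => pol z.1 z.2) := hpol.contDiff.continuous
  have hG₀ : ∀ k, MeasurableSet (G₀ k) := fun k =>
    measurableSet_exists_param (pol := pol) (g := polHat) (fun x => hpolc.comp (Continuous.prodMk_right x))
      (fun x => hhat.comp measurable_prodMk_right)
      ((isCompact_closedBall _ _).inter_right Metric.isClosed_closedBall) u
  let h : Euc q → Euc d → (Euc d [×j]→L[ℝ] Euc m) := fun θ x =>
    iteratedFDeriv ℝ j (fun x => pol x θ) x - iteratedFDeriv ℝ j (fun x => pol x θs) x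
  have hhc : ∀ θ, Continuous (h θ) := fun θ => by
    have hc : ∀ θ, Continuous (iteratedFDeriv ℝ j (fun x => pol x θ)) := fun θ =>
      (hpol.contDiff_policy θ).continuous_iteratedFDeriv
        (by exact_mod_cast (by omega : j ≤ p + 2))
    exact (hc θ).sub (hc θs)
  -- The expert term cancels in the difference over `θ`, leaving a second difference of the family
  -- itself.
  have hlip : ∀ θ θ', ‖θ‖ ≤ Bθ → ‖θ'‖ ≤ Bθ → ∀ x x', ‖x‖ ≤ BX → ‖x'‖ ≤ BX →
      ‖(h θ' x' - h θ' x) - (h θ x' - h θ x)‖ ≤ L * ‖θ' - θ‖ * (2 * BX) := by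
    intro θ θ' hθ hθ' x x' hx hx'
    have hF : ContDiff ℝ ((j + 2 : ℕ) : ℕ∞) (fun z : Euc d × Euc q => pol z.1 z.2) :=
      hpol.contDiff.of_le (by exact_mod_cast (by omega : j + 2 ≤ p + 2))
    have h1 := norm_iteratedFDeriv_slice_second_diff_le hF (convex_closedBall (0 : Euc d) BX)
      (convex_closedBall (0 : Euc q) Bθ) (L := L) (fun x hx θ hθ =>
        (hpol.norm_mixed_le hj (mem_closedBall_zero_iff.1 hx)
          (mem_closedBall_zero_iff.1 hθ)).trans hL)
      (mem_closedBall_zero_iff.2 hθ) (mem_closedBall_zero_iff.2 hθ')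
      (mem_closedBall_zero_iff.2 hx) (mem_closedBall_zero_iff.2 hx')
    have h2 : ‖x' - x‖ ≤ 2 * BX := (norm_sub_le _ _).trans (by linarith)
    calc _ = _ := by
          congr 1
          simp only [h]
          abel
      _ ≤ _ := h1
      _ ≤ _ := by gcongr
  let A : Fin s.card → Set (Euc d × Euc d) := fun k =>
    {w | ∃ t < T, ε / 2 < ‖h (θ k) (traj f polStar w.2 t) - h (θ k) w.1‖}
  have hstarm : Measurable polStar := by
    rw [hstar_eq]
    exact (hpol.contDiff_policy θs).continuous.measurable
  have hA : ∀ k, MeasurableSet (A k) := fun k =>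
    measurableSet_exists_dist_gt (hhc (θ k)) (fun t => measurable_traj hf hstarm t) T (ε / 2)
  -- Several cells may contain a parameter of the learned policy; disjointing selects one of them,
  -- measurably in the sample.
  have hG : ∀ k, MeasurableSet (disjointed G₀ k) := fun k => by
    rw [disjointed_apply, Finset.sup_set_eq_biUnion]
    exact (hG₀ k).diff (Finset.measurableSet_biUnion _ fun l _ => hG₀ l)
  have hmain := measure_consistent_selection_le D n hG (disjoint_disjointed G₀) hA hρ
  refine (measure_mono ?_).trans (hmain.trans ?_)
  · rintro ⟨ξs, ξ⟩ ⟨hξs, hξ, t, ht, hεt⟩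
    simp only at hξs hξ hεt
    have hE := herm ξs hξs
    obtain ⟨θ₁, hθ₁, hθ₁e⟩ := hE.1
    obtain ⟨c, hc, hcd⟩ := hscov θ₁ hθ₁
    have hmem : ξs ∈ ⋃ k, disjointed G₀ k := by
      rw [iUnion_disjointed]
      refine mem_iUnion.2 ⟨s.equivFin ⟨c, hc⟩, θ₁, ⟨?_, mem_closedBall_zero_iff.2 hθ₁⟩,
        fun i => by rw [hθ₁e]⟩
      simpa [θ] using hcd
    obtain ⟨k, hk⟩ := mem_iUnion.1 hmem
    obtain ⟨θ₂, hθ₂, hθ₂e⟩ := disjointed_subset G₀ k hk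
    -- Agreement on the dense sequence `u` extends to all points by continuity, so the parameter
    -- `θ₂` in the selected cell may replace `θ₁`.
    have hpe : polHat ξs = fun x => pol x θ₂ := by
      have hcont : Continuous (polHat ξs) := by
        rw [hθ₁e]; exact (hpol.contDiff_policy θ₁).continuous
      refine Continuous.ext_on (TopologicalSpace.denseRange_denseSeq (Euc d)) hcont
        (hpol.contDiff_policy θ₂).continuous ?_
      rintro _ ⟨i, rfl⟩
      exact hθ₂e i
    have hθk : ‖θ₂ - θ k‖ ≤ r := by
      rw [← dist_eq_norm]; exact hθ₂.1
    have hθkB : ‖θ k‖ ≤ Bθ := hsball _ (s.equivFin.symm k).2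
    have hθ₂B : ‖θ₂‖ ≤ Bθ := mem_closedBall_zero_iff.1 hθ₂.2
    have hdiff : ∀ x, iteratedFDeriv ℝ j (fun x => polHat ξs x - polStar x) x = h θ₂ x := by
      intro x
      rw [hpe, hstar_eq]
      exact hpol.iteratedFDeriv_sub hj θ₂ θs x
    have hzero : ∀ i, ∀ t < T, h θ₂ (traj f polStar (ξs i) t) = 0 := fun i t ht => by
      rw [← hdiff]
      exact hE.iteratedFDeriv_eq_zero hstarP (by omega) i hj ht
    -- The anchor: the state at time `0` is the initial condition, and `T ≥ 1` puts it into the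
    -- loss.
    have hzero₀ : h θ₂ (ξs 0) = 0 := hzero 0 0 hT
    have hξ₀ : ‖ξs 0‖ ≤ BX := htraj _ (hξs 0) 0
    have hclose : ∀ x, ‖x‖ ≤ BX → ‖h θ₂ x - (h (θ k) x - h (θ k) (ξs 0))‖ ≤ ε / 2 := by
      intro x hx
      have h1 := hlip (θ k) θ₂ hθkB hθ₂B (ξs 0) x hξ₀ hx
      rw [hzero₀, sub_zero] at h1
      calc _ ≤ L * ‖θ₂ - θ k‖ * (2 * BX) := h1
        _ ≤ L * r * (2 * BX) := by gcongr
        _ = ε / 2 := by rw [hr]; field_simp; ring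
    refine ⟨k, hk, ?_, t, ht, ?_⟩
    · rintro i ⟨t, ht, hlt⟩
      have h1 := hclose _ (htraj _ (hξs i.succ) t)
      rw [hzero i.succ t ht, zero_sub, norm_neg] at h1
      exact absurd hlt (not_lt.2 h1)
    · have h1 := hclose _ (htraj _ hξ t)
      rw [hdiff] at hεt
      have h2 := norm_le_insert' (h θ₂ (traj f polStar ξ t))
        (h (θ k) (traj f polStar ξ t) - h (θ k) (ξs 0))
      simp only
      linarith
  · have hN : (s.card : ℝ) ≤ (1 + 8 * (Bθ * BX * L / ε)) ^ q := by
      have e : 1 + 2 * Bθ / r = 1 + 8 * (Bθ * BX * L / ε) := by rw [hr]; field_simp; ring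
      rwa [e, finrank_euclideanSpace_fin] at hscard
    rw [Fintype.card_fin, ENNReal.ofReal_add hρ (by positivity),
      ENNReal.ofReal_mul (by positivity)]
    gcongr
    rw [← ENNReal.ofReal_natCast]
    exact ENNReal.ofReal_le_ofReal hN

end Generalization

/-! ### Sample sizes for the two accuracies -/

section SampleSize

/-- Both summands are at most `ρ = δ / (4 (p+1))`. The size condition counts `n + 1` samples because
one serves as the anchor; the loss is absorbed by `n ≥ (n + 1) / 2`. -/
lemma add_pow_mul_exp_le {p q n : ℕ} (hp : 1 ≤ p) (hq : 1 ≤ q) {δ w : ℝ} (hδ : 0 < δ) (hδ1 : δ < 1)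
    (hw : 1 ≤ w)
    (hn : 16 * p / δ * (q * Real.log (9 * w) + Real.log (8 * p / δ)) ≤ ((n + 1 : ℕ) : ℝ)) :
    δ / (4 * (p + 1)) + (1 + 8 * w) ^ q * Real.exp (-(δ / (4 * (p + 1)) * n)) ≤
      δ / (2 * (p + 1)) := by
  have hp' : (1 : ℝ) ≤ p := by exact_mod_cast hp
  have hq' : (1 : ℝ) ≤ q := by exact_mod_cast hq
  set ρ := δ / (4 * ((p : ℝ) + 1)) with hρ
  have hρ0 : 0 < ρ := by positivity
  set Z := q * Real.log (9 * w) + Real.log (8 * p / δ) with hZ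
  have h8 : 8 ≤ 8 * p / δ := by
    rw [le_div_iff₀ hδ]
    nlinarith
  have hl9 : 1 ≤ Real.log (9 * w) := by
    rw [Real.le_log_iff_exp_le (by positivity)]
    linarith [Real.exp_one_lt_d9]
  have hl8 : 0 ≤ Real.log (8 * p / δ) := Real.log_nonneg (by linarith)
  have hZ1 : 1 ≤ Z := by nlinarith
  have hpδ : 1 ≤ p / δ := by rw [le_div_iff₀ hδ]; linarith
  have hn2 : (2 : ℝ) ≤ ((n + 1 : ℕ) : ℝ) := by
    have e : 16 * p / δ * Z = 16 * (p / δ * Z) := by ring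
    rw [e] at hn
    nlinarith [mul_le_mul hpδ hZ1 zero_le_one (by positivity)]
  push_cast at hn hn2
  have hn' : 8 * p / δ * Z ≤ n := by
    have e : 16 * p / δ * Z = 2 * (8 * p / δ * Z) := by ring
    rw [e] at hn
    linarith
  have hρn : Z ≤ ρ * n := by
    calc Z ≤ 2 * p / (p + 1) * Z := by
          have : 1 ≤ 2 * (p : ℝ) / (p + 1) := by rw [le_div_iff₀ (by positivity)]; linarith
          nlinarith
      _ = ρ * (8 * p / δ * Z) := by rw [hρ]; field_simp; ring
      _ ≤ ρ * n := by gcongr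
  have hρlog : -Real.log (8 * p / δ) ≤ Real.log ρ := by
    rw [← Real.log_inv]
    refine Real.log_le_log (by positivity) ?_
    rw [hρ, inv_div]
    exact div_le_div_of_nonneg_left hδ.le (by positivity) (by linarith)
  have hpow : (1 + 8 * w) ^ q ≤ Real.exp (q * Real.log (9 * w)) := by
    rw [Real.exp_nat_mul, Real.exp_log (by positivity)]
    gcongr
    linarith
  have hmain : (1 + 8 * w) ^ q * Real.exp (-(ρ * n)) ≤ ρ := by
    calc _ ≤ Real.exp (q * Real.log (9 * w)) * Real.exp (-(ρ * n)) := by gcongr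
      _ = Real.exp (q * Real.log (9 * w) - ρ * n) := by rw [← Real.exp_add]; congr 1
      _ ≤ Real.exp (Real.log ρ) := Real.exp_le_exp.2 (by linarith)
      _ = ρ := Real.exp_log hρ0
  have e : δ / (2 * ((p : ℝ) + 1)) = ρ + ρ := by rw [hρ]; field_simp; ring
  rw [e]
  linarith

/-- The accuracy `ε ~ B * p * q * log (c * n) / (δ * n)` is trivial or is reached by `n` samples. -/
lemma sampleSize_rate {p q n : ℕ} (hp : 1 ≤ p) (hq : 1 ≤ q) (hn : 1 ≤ n) {δ B c : ℝ} (hδ : 0 < δ)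
    (hδ1 : δ < 1) (hB : 0 < B) (hc : 2 ≤ c) {ε : ℝ}
    (hε : ε = 64 * (p / δ * (B * q * Real.log (c * n) / n))) :
    0 < ε ∧ (2 * B ≤ ε ∨ (1 ≤ c * B / ε ∧
      16 * p / δ * (q * Real.log (9 * (c * B / ε)) + Real.log (8 * p / δ)) ≤ n)) := by
  have hp' : (1 : ℝ) ≤ p := by exact_mod_cast hp
  have hq' : (1 : ℝ) ≤ q := by exact_mod_cast hq
  have hn' : (1 : ℝ) ≤ n := by exact_mod_cast hn
  have hcn : 2 ≤ c * n := by nlinarith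
  set l := Real.log (c * n) with hl
  have hl2 : 1 / 2 ≤ l := by
    have := Real.log_le_log (by norm_num) hcn
    linarith [Real.log_two_gt_d9]
  have hε0 : 0 < ε := by rw [hε]; positivity
  refine ⟨hε0, ?_⟩
  by_cases h2 : 2 * B ≤ ε
  · exact Or.inl h2
  right
  rw [not_le] at h2
  have hw : 1 ≤ c * B / ε := by rw [le_div_iff₀ hε0]; nlinarith
  refine ⟨hw, ?_⟩
  -- Nontriviality `ε < 2 B` is itself a lower bound on `n`, as `B` cancels; no separate burn-in is
  -- needed for this accuracy.
  have hbig : 32 * (p / δ * (q * l)) < n := by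
    rw [hε] at h2
    have e : 64 * (p / δ * (B * q * l / n)) = 2 * B * (32 * (p / δ * (q * l)) / n) := by
      field_simp; ring
    rw [e] at h2
    have h3 : 32 * (p / δ * (q * l)) / n < 1 := by
      by_contra! hcon
      nlinarith
    rwa [div_lt_one (by positivity)] at h3
  have hql : 1 / 2 ≤ q * l := by nlinarith
  have hpδ0 : 0 < p / δ := by positivity
  have h8 : 8 * p / δ ≤ n := by
    have : 8 * p / δ = 8 * (p / δ) := by ring
    nlinarith
  have hpδ1 : 1 ≤ p / δ := by rw [le_div_iff₀ hδ]; linarith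
  have hlog8 : Real.log (8 * p / δ) ≤ q * l := by
    have h1 : Real.log (8 * p / δ) ≤ l :=
      Real.log_le_log (by positivity) (h8.trans (by nlinarith))
    nlinarith
  have hlog9 : Real.log (9 * (c * B / ε)) ≤ l := by
    refine Real.log_le_log (by positivity) ?_
    have e : 9 * (c * B / ε) = c * n * (9 / (64 * (p / δ * (q * l)))) := by
      rw [hε]; field_simp
    rw [e]
    refine mul_le_of_le_one_right (by positivity) ?_
    rw [div_le_one (by positivity)]
    nlinarith
  calc 16 * p / δ * (q * Real.log (9 * (c * B / ε)) + Real.log (8 * p / δ)) ≤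
        16 * p / δ * (q * l + q * l) := by gcongr
    _ = 32 * (p / δ * (q * l)) := by ring
    _ ≤ n := hbig.le

/-- Under the burn-in condition, the accuracy `ε = p * q / (4 * κ)` is trivial or is reached by `n`
samples. -/
lemma sampleSize_burnIn {p q n : ℕ} (hp : 1 ≤ p) (hq : 1 ≤ q) {δ B c κ : ℝ} (hδ : 0 < δ)
    (hδ1 : δ < 1) (hB : 0 < B) (hc : 2 ≤ c) (hκ : (p : ℝ) * q / 2 ≤ κ)
    (hn : 400 * burnInTerm 400 B κ c δ ≤ n) {ε : ℝ} (hε : ε = p * q / (4 * κ)) :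
    0 < ε ∧ (2 * B ≤ ε ∨ (1 ≤ c * B / ε ∧
      16 * p / δ * (q * Real.log (9 * (c * B / ε)) + Real.log (8 * p / δ)) ≤ n)) := by
  have hp' : (1 : ℝ) ≤ p := by exact_mod_cast hp
  have hq' : (1 : ℝ) ≤ q := by exact_mod_cast hq
  have hpq : (1 : ℝ) ≤ p * q := by nlinarith
  have hκ0 : 0 < κ := by linarith
  have hε0 : 0 < ε := by rw [hε]; positivity
  refine ⟨hε0, ?_⟩
  by_cases h2 : 2 * B ≤ ε
  · exact Or.inl h2
  right
  rw [not_le] at h2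
  refine ⟨by rw [le_div_iff₀ hε0]; nlinarith, ?_⟩
  set Λ := Real.log (400 * (κ * c / δ)) with hΛ
  -- This is `2 B / ε`, hence at least `1` in the nontrivial case.
  set y := 8 * B * κ / (p * q) with hy
  have hy1 : 1 ≤ y := by
    rw [hε, div_lt_iff₀ (by positivity)] at h2
    rw [hy, le_div_iff₀ (by positivity)]
    linarith
  have harg : 200 * ((p : ℝ) * q * c / δ) ≤ 400 * (κ * c / δ) := by
    have : p * q / 2 * c / δ ≤ κ * c / δ := by gcongr
    calc 200 * ((p : ℝ) * q * c / δ) = 400 * (p * q / 2 * c / δ) := by ring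
      _ ≤ _ := by gcongr
  have hpδ : p / δ ≤ (p : ℝ) * q * c / δ := by
    gcongr
    nlinarith
  have hcδ : c ≤ (p : ℝ) * q * c / δ := by
    rw [le_div_iff₀ hδ]
    nlinarith
  have hΛ8 : Real.log (8 * p / δ) ≤ Λ := by
    refine Real.log_le_log (by positivity) (le_trans ?_ harg)
    have e : 8 * p / δ = 8 * (p / δ) := by ring
    have : 0 ≤ (p : ℝ) / δ := by positivity
    linarith
  have hΛc : Real.log (9 / 2 * c) ≤ Λ :=
    Real.log_le_log (by positivity) (le_trans (by linarith) harg)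
  have hΛ1 : 1 ≤ Λ := by
    rw [hΛ, Real.le_log_iff_exp_le (by positivity)]
    linarith [Real.exp_one_lt_d9]
  have hlog9 : Real.log (9 * (c * B / ε)) ≤ Λ + y := by
    have e : 9 * (c * B / ε) = 9 / 2 * c * y := by rw [hε, hy]; field_simp; ring
    rw [e, Real.log_mul (by positivity) (by positivity)]
    exact add_le_add hΛc ((Real.log_le_sub_one_of_pos (by linarith)).trans (by linarith))
  -- Both `y` and `Λ` are at least `1`. The resulting factor `16 * 3 * 8 = 384` explains the
  -- constant `400`.
  have hΛy : Λ + y + Λ ≤ 3 * (y * Λ) := by nlinarith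
  calc 16 * p / δ * (q * Real.log (9 * (c * B / ε)) + Real.log (8 * p / δ)) ≤
        16 * p / δ * (q * (Λ + y) + q * Λ) := by
        gcongr
        nlinarith
    _ = 16 * p / δ * q * (Λ + y + Λ) := by ring
    _ ≤ 16 * p / δ * q * (3 * (y * Λ)) := by gcongr
    _ = 384 * (B * κ / δ * Λ) := by rw [hy]; field_simp; ring
    _ ≤ 400 * (B * κ / δ * Λ) := by
      have : 0 ≤ B * κ / δ * Λ := by positivity
      linarith
    _ ≤ n := hn

end SampleSize

/-! ### High-probability form -/

section Generalization

variable {d m q p T n : ℕ} {pol : Euc d → Euc q → Euc m} {BX Bθ : ℝ}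

/-- High-probability form of the bound on the derivative errors along a fresh expert trajectory. -/
lemma measure_derivError_le_of_sampleSize (hpol : IsPolicyFamily p pol)
    {f : Euc d → Euc m → Euc d}
    (hf : Measurable (fun z : Euc d × Euc m => f z.1 z.2)) {X : Set (Euc d)}
    (D : Measure (Euc d)) [IsProbabilityMeasure D] {polStar : Euc d → Euc m}
    (hstar : polStar ∈ policyClass pol Bθ) (hBX : 0 < BX)
    (htraj : ∀ ξ ∈ X, ∀ t : ℕ, ‖traj f polStar ξ t‖ ≤ BX) (hT : 1 ≤ T)
    {polHat : (Fin (n + 1) → Euc d) → Euc d → Euc m}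
    (hhat : Measurable (fun z : (Fin (n + 1) → Euc d) × Euc d => polHat z.1 z.2))
    (herm : ∀ ξs : Fin (n + 1) → Euc d, (∀ i, ξs i ∈ X) →
      IsERM f polStar p T (policyClass pol Bθ) ξs (polHat ξs))
    {j : ℕ} (hj : j ≤ p) {L B : ℝ} (hB : B = derivBound pol BX Bθ j) (hL0 : 0 < B → 0 < L)
    (hL : mixedDerivBound pol BX Bθ j ≤ L)
    {ε δ : ℝ} (hp : 1 ≤ p) (hq : 1 ≤ q) (hδ : 0 < δ) (hδ1 : δ < 1)
    (hε : 2 * B ≤ ε ∨ (0 < B ∧ 0 < ε ∧ 1 ≤ Bθ * BX * L / ε ∧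
      16 * p / δ * (q * Real.log (9 * (Bθ * BX * L / ε)) + Real.log (8 * p / δ)) ≤
        ((n + 1 : ℕ) : ℝ))) :
    ((Measure.pi (fun _ : Fin (n + 1) => D)).prod D)
      {z | (∀ i, z.1 i ∈ X) ∧ z.2 ∈ X ∧ ∃ t < T, ε <
        ‖iteratedFDeriv ℝ j (fun x => polHat z.1 x - polStar x) (traj f polStar z.2 t)‖} ≤
      ENNReal.ofReal (δ / (2 * (p + 1))) := by
  rcases hε with h2 | ⟨hB0, hε0, hw, hn⟩
  -- Two members of the class have `j`-th derivatives of norm at most `B`, so an error above `2 B`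
  -- never occurs. This also covers `B = 0`.
  · have : {z : (Fin (n + 1) → Euc d) × Euc d | (∀ i, z.1 i ∈ X) ∧ z.2 ∈ X ∧ ∃ t < T, ε <
        ‖iteratedFDeriv ℝ j (fun x => polHat z.1 x - polStar x) (traj f polStar z.2 t)‖} = ∅ := by
      rw [eq_empty_iff_forall_notMem]
      rintro ⟨ξs, ξ⟩ ⟨hξs, hξ, t, ht, hlt⟩
      obtain ⟨θs, hθs, hse⟩ := hstar
      obtain ⟨θ, hθ, he⟩ := (herm ξs hξs).1
      simp only at hlt
      rw [he, hse, hpol.iteratedFDeriv_sub hj] at hlt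
      have hx := htraj ξ hξ t
      rw [hse] at hx
      have h3 := (norm_sub_le _ _).trans (add_le_add (hpol.norm_iteratedFDeriv_le hj hx hθ)
        (hpol.norm_iteratedFDeriv_le hj hx hθs))
      rw [← hB] at h3
      linarith
    rw [this, measure_empty]
    exact zero_le
  · exact (measure_derivError_le hpol hf D hstar hBX htraj hT hhat herm hj (hL0 hB0) hL hε0
      (ρ := δ / (4 * (p + 1))) (by positivity)).trans
      (ENNReal.ofReal_le_ofReal (add_pow_mul_exp_le hp hq hδ hδ1 hw hn))

end Generalization

/-! ### Thresholds, the shape of the rate and null sets -/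

section Rates

lemma half_le_kappaAlpha {p q j : ℕ} {r μ α : ℝ} (hj : j ≤ p) (hμ : 0 < μ) (hα : 0 < α)
    (h : (α / μ) ^ r * (p.factorial : ℝ) ≤ 2) : (p : ℝ) * q / 2 ≤ kappaAlpha p q r μ α j := by
  have hj0 : (0 : ℝ) < j.factorial := by exact_mod_cast Nat.factorial_pos _
  have hjp : (j.factorial : ℝ) ≤ p.factorial := by exact_mod_cast Nat.factorial_le hj
  have hx : 0 < (α / μ) ^ r := by positivity
  have e : (μ / α) ^ r = ((α / μ) ^ r)⁻¹ := by rw [← Real.inv_rpow (by positivity), inv_div]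
  unfold kappaAlpha
  rw [e, inv_mul_eq_div, div_div, div_le_div_iff₀ (by positivity) (by positivity)]
  have h1 : (j.factorial : ℝ) * (α / μ) ^ r ≤ 2 :=
    (mul_le_mul_of_nonneg_right hjp hx.le).trans (by linarith)
  exact mul_le_mul_of_nonneg_left h1 (by positivity)

lemma div_kappaAlpha {p q j : ℕ} {r μ α : ℝ} (hp : 1 ≤ p) (hq : 1 ≤ q) (hμ : 0 < μ) (hα : 0 < α) :
    (p : ℝ) * q / (4 * kappaAlpha p q r μ α j) = j.factorial * (α / μ) ^ r / 4 := by
  have hj0 : (0 : ℝ) < j.factorial := by exact_mod_cast Nat.factorial_pos _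
  have hp' : (0 : ℝ) < p := by exact_mod_cast hp
  have hq' : (0 : ℝ) < q := by exact_mod_cast hq
  have hx : 0 < (α / μ) ^ r := by positivity
  have e : (μ / α) ^ r = ((α / μ) ^ r)⁻¹ := by rw [← Real.inv_rpow (by positivity), inv_div]
  unfold kappaAlpha
  rw [e]
  field_simp

lemma imitationGap_self {d m T : ℕ} (f : Euc d → Euc m → Euc d) (pol : Euc d → Euc m)
    (ξ : Euc d) : imitationGap f pol pol T ξ = 0 := by
  simp [imitationGap]

/-- A power of `2 * M j / j!` is dominated by the supremum in the rate. -/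
lemma two_mul_div_rpow_le {p : ℕ} {r δ : ℝ} (hr : 1 ≤ r) (hδ : 0 < δ) {a M : ℕ → ℝ} {C : ℝ}
    (hC : 128 ≤ C) (j : Fin (p + 1)) (ha : 0 ≤ a j) (hM0 : 0 ≤ M j)
    (hM : M j ≤ 64 * (p / δ * a j)) :
    (2 * M j / (j : ℕ).factorial) ^ (1 / r) ≤
      C * ⨆ j : Fin (p + 1), ((p : ℝ) / ((j : ℕ).factorial * δ) * a j) ^ (1 / r) := by
  have hj0 : (0 : ℝ) < (j : ℕ).factorial := by exact_mod_cast Nat.factorial_pos _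
  have hr0 : 0 < r := by linarith
  have hC1 : 1 ≤ C := by linarith
  have hb : 0 ≤ (p : ℝ) / ((j : ℕ).factorial * δ) * a j := by positivity
  calc (2 * M j / (j : ℕ).factorial) ^ (1 / r)
      ≤ (C * ((p : ℝ) / ((j : ℕ).factorial * δ) * a j)) ^ (1 / r) := by
        gcongr
        calc 2 * M j / (j : ℕ).factorial ≤ 2 * (64 * (p / δ * a j)) / (j : ℕ).factorial := by
              gcongr
          _ = 128 * ((p : ℝ) / ((j : ℕ).factorial * δ) * a j) := by field_simp; ring
          _ ≤ _ := by gcongr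
    _ = C ^ (1 / r) * ((p : ℝ) / ((j : ℕ).factorial * δ) * a j) ^ (1 / r) :=
      Real.mul_rpow (by linarith) hb
    _ ≤ C * ((p : ℝ) / ((j : ℕ).factorial * δ) * a j) ^ (1 / r) := by
      gcongr
      calc C ^ (1 / r) ≤ C ^ (1 : ℝ) :=
            Real.rpow_le_rpow_of_exponent_le hC1 ((div_le_one hr0).2 hr)
        _ = C := Real.rpow_one _
    _ ≤ _ := by
      gcongr
      exact le_ciSup (f := fun j : Fin (p + 1) =>
        ((p : ℝ) / ((j : ℕ).factorial * δ) * a j) ^ (1 / r)) (Set.finite_range _).bddAbove j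

lemma ofReal_one_sub_le_measure {Ω : Type*} [MeasurableSpace Ω] (P : Measure Ω)
    [IsProbabilityMeasure P] {s : Set Ω} {δ : ℝ} (hδ : 0 ≤ δ) (h : P sᶜ ≤ ENNReal.ofReal δ) :
    ENNReal.ofReal (1 - δ) ≤ P s := by
  rw [ENNReal.ofReal_sub _ hδ, ENNReal.ofReal_one, tsub_le_iff_right]
  calc (1 : ENNReal) = P univ := measure_univ.symm
    _ ≤ P s + P sᶜ := by rw [← union_compl_self s]; exact measure_union_le _ _
    _ ≤ _ := by gcongr

lemma measure_sample_notMem_eq_zero {Ω : Type*} [MeasurableSpace Ω] (D : Measure Ω)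
    [IsProbabilityMeasure D] {X : Set Ω} (hX : D Xᶜ = 0) (n : ℕ) :
    ((Measure.pi (fun _ : Fin n => D)).prod D) {z | (∀ i, z.1 i ∈ X) ∧ z.2 ∈ X}ᶜ = 0 := by
  have h1 : ∀ᵐ z ∂((Measure.pi (fun _ : Fin n => D)).prod D), ∀ i, z.1 i ∈ X := by
    rw [ae_all_iff]
    intro i
    have h2 : ∀ᵐ ξs ∂(Measure.pi (fun _ : Fin n => D)), ξs i ∈ X :=
      (measurePreserving_eval (fun _ : Fin n => D) i).quasiMeasurePreserving.ae
        (mem_ae_iff.2 hX)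
    exact Measure.quasiMeasurePreserving_fst.ae h2
  have h3 : ∀ᵐ z ∂((Measure.pi (fun _ : Fin n => D)).prod D), z.2 ∈ X :=
    Measure.quasiMeasurePreserving_snd.ae (mem_ae_iff.2 hX)
  exact mem_ae_iff.1 (h1.and h3)

end Rates

end TaSIL

/-! ### Assembly -/

theorem mainTheorem1 :
    -- one universal constant for all the `O(1)`s
    ∃ C : ℝ, 0 < C ∧
      ∀ (d m q p n T : ℕ), 1 ≤ n → 1 ≤ T →
      -- dynamics, initial conditions and their distribution
      ∀ (f : TaSIL.Euc d → TaSIL.Euc m → TaSIL.Euc d),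
        Measurable (fun z : TaSIL.Euc d × TaSIL.Euc m => f z.1 z.2) →
      ∀ (X : Set (TaSIL.Euc d)), IsCompact X →
      ∀ (D : Measure (TaSIL.Euc d)) [IsProbabilityMeasure D], D Xᶜ = 0 →
      -- parametric policy class and realizability
      ∀ (pol : TaSIL.Euc d → TaSIL.Euc q → TaSIL.Euc m) (Bθ : ℝ),
        TaSIL.IsPolicyFamily p pol →
      ∀ polStar ∈ TaSIL.policyClass pol Bθ,
      -- Lyapunov stability of the expert closed loop
      ∀ BX : ℝ, 0 < BX → (∀ ξ ∈ X, ∀ t : ℕ, ‖TaSIL.traj f polStar ξ t‖ ≤ BX) →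
      -- local incremental stability of the expert, with gain `O(x ^ (1/r))`
      ∀ (η r : ℝ) (γ : ℝ → ℝ), 0 < η → 1 ≤ r → 0 < (p : ℝ) + 1 - r →
        TaSIL.IsLocallyDISS f X polStar η γ →
        γ =O[𝓝[>] (0 : ℝ)] (fun x : ℝ => x ^ (1 / r)) →
      -- Taylor remainder bound, uniform over the policy class
      ∀ Lp : ℝ, 0 ≤ Lp →
        (∀ π' ∈ TaSIL.policyClass pol Bθ, TaSIL.HasTaylorBound p Lp π') →
      ∀ μ α : ℝ, 0 < μ → 0 < α → α ≤ 1 / 2 →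
        TaSIL.NeighborhoodRelation p Lp r μ α γ →
        (α / μ) ^ r * (p.factorial : ℝ) ≤ 2 →
      -- the constants `B j`, `L j`, with `L j` enlarged if necessary
      ∀ B L : ℕ → ℝ,
        (∀ j ≤ p, B j = TaSIL.derivBound pol BX Bθ j) →
        (∀ j ≤ p, TaSIL.mixedDerivBound pol BX Bθ j ≤ L j ∧ 2 * B j ≤ Bθ * BX * L j) →
      -- the learned policy, as a function of the sampled initial conditions
      ∀ polHat : (Fin n → TaSIL.Euc d) → TaSIL.Euc d → TaSIL.Euc m,
        Measurable (fun z : (Fin n → TaSIL.Euc d) × TaSIL.Euc d => polHat z.1 z.2) →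
        (∀ ξs : Fin n → TaSIL.Euc d, (∀ i, ξs i ∈ X) →
          TaSIL.IsERM f polStar p T (TaSIL.policyClass pol Bθ) ξs (polHat ξs)) →
      ∀ δ : ℝ, 0 < δ → δ < 1 →
        -- burn-in
        C * (⨆ j : Fin (p + 1), max
            (TaSIL.burnInTerm C (B j) (TaSIL.kappaAlpha p q r μ α j)
              (Bθ * (B j)⁻¹ * BX * L j) δ)
            (TaSIL.burnInTerm C (B j) (TaSIL.kappaEta p q r μ Lp η δ j)
              (Bθ * (B j)⁻¹ * BX * L j) δ)) ≤ (n : ℝ) →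
        ENNReal.ofReal (1 - δ) ≤
          ((Measure.pi (fun _ : Fin n => D)).prod D)
            {z : (Fin n → TaSIL.Euc d) × TaSIL.Euc d |
              TaSIL.imitationGap f polStar (polHat z.1) T z.2 ≤
                C * μ * ⨆ j : Fin (p + 1),
                  ((p : ℝ) / ((j : ℕ).factorial * δ) *
                    (B j * q * Real.log (Bθ * (B j)⁻¹ * BX * L j * n) / n)) ^ (1 / r)} := by
  refine ⟨400, by norm_num, ?_⟩
  intro d m q p n T hn hT f hf X _ D _ hDX pol Bθ hpol polStar hstar BX hBX htraj η r γ hη hr hpr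
    hstab _ Lp hLp htaylor μ α hμ hα0 hα hnbhd hαp B L hB hL polHat hhat herm δ hδ hδ1 hburn
  -- `1 ≤ r < p + 1` excludes `p = 0`.
  have hp : 1 ≤ p := by
    rw [Nat.one_le_iff_ne_zero]
    rintro rfl
    norm_num at hpr
    linarith
  obtain ⟨n, rfl⟩ : ∃ n', n = n' + 1 := ⟨n - 1, by omega⟩
  have hBθ : 0 ≤ Bθ := by
    obtain ⟨θ, hθ, -⟩ := hstar
    exact (norm_nonneg _).trans hθ
  refine TaSIL.ofReal_one_sub_le_measure _ hδ.le ?_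
  have hsupp := TaSIL.measure_sample_notMem_eq_zero D hDX (n + 1)
  set P := (Measure.pi (fun _ : Fin (n + 1) => D)).prod D with hP
  set Z : Set ((Fin (n + 1) → TaSIL.Euc d) × TaSIL.Euc d) := {z | (∀ i, z.1 i ∈ X) ∧ z.2 ∈ X}
    with hZ
  rcases Nat.eq_zero_or_pos q with rfl | hq
  -- With `q = 0` the class has a single member, so the gap is zero on the support.
  · refine (measure_mono ?_).trans (hsupp.le.trans zero_le)
    rw [compl_subset_compl]
    rintro z ⟨hz, -⟩
    obtain ⟨θ, -, hθ⟩ := (herm z.1 hz).1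
    obtain ⟨θs, -, hθs⟩ := hstar
    have e : polHat z.1 = polStar := by rw [hθ, hθs, Subsingleton.elim θ θs]
    rw [mem_ofPred_eq, e, TaSIL.imitationGap_self]
    refine mul_nonneg (by positivity) (Real.iSup_nonneg fun j => Real.rpow_nonneg ?_ _)
    simp
  have hp' : (1 : ℝ) ≤ p := by exact_mod_cast hp
  have hq' : (1 : ℝ) ≤ q := by exact_mod_cast hq
  let κα : ℕ → ℝ := TaSIL.kappaAlpha p q r μ α
  let κη : ℕ → ℝ := TaSIL.kappaEta p q r μ Lp η δ
  let κ : ℕ → ℝ := fun j => max (κα j) (κη j)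
  let c : ℕ → ℝ := fun j => Bθ * (B j)⁻¹ * BX * L j
  let a : ℕ → ℝ := fun j => B j * q * Real.log (c j * (n + 1 : ℕ)) / (n + 1 : ℕ)
  let ε₁ : ℕ → ℝ := fun j => 64 * (p / δ * a j)
  -- Chosen so that `κα` bounds it by `j! (α/μ)^r / 4`, and `κη` bounds its product with the bracket
  -- of `kappaEta` by `η δ / 4`.
  let ε₂ : ℕ → ℝ := fun j => p * q / (4 * κ j)
  have hB0 : ∀ j ≤ p, 0 ≤ B j := fun j hj => by
    rw [hB j hj]
    refine Real.sSup_nonneg ?_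
    rintro _ ⟨z, -, rfl⟩
    exact norm_nonneg _
  have hκα : ∀ j ≤ p, (p : ℝ) * q / 2 ≤ κα j := fun j hj =>
    TaSIL.half_le_kappaAlpha hj hμ hα0 hαp
  have hκ : ∀ j ≤ p, (p : ℝ) * q / 2 ≤ κ j := fun j hj => (hκα j hj).trans (le_max_left _ _)
  have hκ0 : ∀ j ≤ p, 0 < κ j := fun j hj => lt_of_lt_of_le (by positivity) (hκ j hj)
  have hc : ∀ j ≤ p, 0 < B j → 2 ≤ c j ∧ c j * B j = Bθ * BX * L j := fun j hj hBj => by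
    have e : c j * B j = Bθ * BX * L j := by
      simp only [c]
      field_simp
    refine ⟨?_, e⟩
    have := (hL j hj).2
    rw [← e] at this
    exact le_of_mul_le_mul_right this hBj
  have hL0 : ∀ j ≤ p, 0 < B j → 0 < L j := fun j hj hBj => by
    have h1 := (hL j hj).2
    by_contra! hcon
    have : Bθ * BX * L j ≤ 0 := mul_nonpos_of_nonneg_of_nonpos (by positivity) hcon
    linarith
  have hburn_j : ∀ j ≤ p, 400 * TaSIL.burnInTerm 400 (B j) (κ j) (c j) δ ≤ ((n + 1 : ℕ) : ℝ) := by
    intro j hj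
    refine le_trans ?_ hburn
    refine mul_le_mul_of_nonneg_left ?_ (by norm_num)
    refine le_trans ?_ (le_ciSup (f := fun j : Fin (p + 1) => max
      (TaSIL.burnInTerm 400 (B j) (TaSIL.kappaAlpha p q r μ α j) (Bθ * (B j)⁻¹ * BX * L j) δ)
      (TaSIL.burnInTerm 400 (B j) (TaSIL.kappaEta p q r μ Lp η δ j)
        (Bθ * (B j)⁻¹ * BX * L j) δ)) (Set.finite_range _).bddAbove ⟨j, Nat.lt_succ_iff.2 hj⟩)
    -- The maximum is one of the two, so its burn-in term occurs in the hypothesis as it stands; no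
    -- monotonicity in `κ` is involved.
    rcases max_choice (κα j) (κη j) with h | h
    · simp only [κ, h]
      exact le_max_left _ _
    · simp only [κ, h]
      exact le_max_right _ _
  have hsize : ∀ j ≤ p, ∀ ε, ε = ε₁ j ∨ ε = ε₂ j → 0 ≤ ε ∧ (2 * B j ≤ ε ∨
      (0 < B j ∧ 0 < ε ∧ 1 ≤ Bθ * BX * L j / ε ∧ 16 * p / δ *
        (q * Real.log (9 * (Bθ * BX * L j / ε)) + Real.log (8 * p / δ)) ≤ ((n + 1 : ℕ) : ℝ))) := by
    intro j hj ε hε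
    rcases (hB0 j hj).eq_or_lt with hBj | hBj
    · have h0 : 0 ≤ ε := by
        rcases hε with rfl | rfl
        · simp [ε₁, a, ← hBj]
        · exact div_nonneg (by positivity) (by linarith [hκ0 j hj])
      exact ⟨h0, Or.inl (by rw [← hBj]; simpa using h0)⟩
    · obtain ⟨hc2, hcB⟩ := hc j hj hBj
      rw [← hcB]
      have h1 : 0 < ε ∧ (2 * B j ≤ ε ∨ (1 ≤ c j * B j / ε ∧ 16 * p / δ *
          (q * Real.log (9 * (c j * B j / ε)) + Real.log (8 * p / δ)) ≤ ((n + 1 : ℕ) : ℝ))) := by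
        rcases hε with h | h
        · exact TaSIL.sampleSize_rate hp hq hn hδ hδ1 hBj hc2 h
        · exact TaSIL.sampleSize_burnIn hp hq hδ hδ1 hBj hc2 (hκ j hj) (hburn_j j hj) h
      exact ⟨h1.1.le, h1.2.imp_right fun h => ⟨hBj, h1.1, h.1, h.2⟩⟩
  let bad : ℝ → ℕ → Set ((Fin (n + 1) → TaSIL.Euc d) × TaSIL.Euc d) := fun ε j =>
    {z | (∀ i, z.1 i ∈ X) ∧ z.2 ∈ X ∧ ∃ t < T, ε <
      ‖iteratedFDeriv ℝ j (fun x => polHat z.1 x - polStar x) (TaSIL.traj f polStar z.2 t)‖}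
  have hbad : ∀ j ≤ p, ∀ ε, ε = ε₁ j ∨ ε = ε₂ j →
      P (bad ε j) ≤ ENNReal.ofReal (δ / (2 * (p + 1))) := fun j hj ε hε =>
    TaSIL.measure_derivError_le_of_sampleSize hpol hf D hstar hBX htraj hT hhat herm hj (hB j hj)
      (hL0 j hj) (hL j hj).1 hp hq hδ hδ1 (hsize j hj ε hε).2
  have hcover : {z : (Fin (n + 1) → TaSIL.Euc d) × TaSIL.Euc d |
      TaSIL.imitationGap f polStar (polHat z.1) T z.2 ≤
        400 * μ * ⨆ j : Fin (p + 1), ((p : ℝ) / ((j : ℕ).factorial * δ) *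
          (B j * q * Real.log (Bθ * (B j)⁻¹ * BX * L j * (n + 1 : ℕ)) / (n + 1 : ℕ))) ^ (1 / r)}ᶜ ⊆
      Zᶜ ∪ ⋃ j : Fin (p + 1), (bad (ε₁ j) j ∪ bad (ε₂ j) j) := by
    rw [compl_subset_comm, compl_union, compl_compl]
    rintro z ⟨⟨hz1, hz2⟩, hz⟩
    have hgood : ∀ j ≤ p, ∀ ε, ε = ε₁ j ∨ ε = ε₂ j → ∀ t < T,
        ‖iteratedFDeriv ℝ j (fun x => polHat z.1 x - polStar x) (TaSIL.traj f polStar z.2 t)‖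
          ≤ ε := by
      intro j hj ε hε t ht
      by_contra! hlt
      have hmem : z ∈ bad ε j := ⟨hz1, hz2, t, ht, hlt⟩
      refine hz (mem_iUnion.2 ⟨⟨j, Nat.lt_succ_iff.2 hj⟩, ?_⟩)
      rcases hε with rfl | rfl
      exacts [Or.inl hmem, Or.inr hmem]
    have hM0 : ∀ j ≤ p, 0 ≤ min (ε₁ j) (ε₂ j) := fun j hj =>
      le_min (hsize j hj _ (Or.inl rfl)).1 (hsize j hj _ (Or.inr rfl)).1
    have hMα : ∀ j ≤ p, min (ε₁ j) (ε₂ j) ≤ j.factorial * (α / μ) ^ r / 4 := by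
      intro j hj
      refine (min_le_right _ _).trans ?_
      rw [← TaSIL.div_kappaAlpha (q := q) hp hq hμ hα0]
      have : 0 < κα j := lt_of_lt_of_le (by positivity) (hκα j hj)
      exact div_le_div_of_nonneg_left (by positivity) (by positivity)
        (mul_le_mul_of_nonneg_left (le_max_left _ _) (by norm_num))
    have hMη : ∀ j ≤ p, min (ε₁ j) (ε₂ j) * (Lp / ((p + 1).factorial : ℝ) *
        (μ ^ (p + 1) / (j.factorial : ℝ) ^ (((p : ℝ) + 1) / r)) + 1 / (j.factorial : ℝ)) ≤
          η / 4 := by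
      intro j hj
      set Q := Lp / ((p + 1).factorial : ℝ) * (μ ^ (p + 1) /
        (j.factorial : ℝ) ^ (((p : ℝ) + 1) / r)) + 1 / (j.factorial : ℝ) with hQ
      have hfac : (0 : ℝ) < j.factorial := by exact_mod_cast Nat.factorial_pos _
      have hQ0 : 0 < Q := by positivity
      have hκη : κη j = Q * ((p : ℝ) * q / (η * δ)) := rfl
      have hκη0 : 0 < κη j := by rw [hκη]; positivity
      calc min (ε₁ j) (ε₂ j) * Q ≤ p * q / (4 * κη j) * Q := by
            refine mul_le_mul_of_nonneg_right ((min_le_right _ _).trans ?_) hQ0.le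
            exact div_le_div_of_nonneg_left (by positivity) (by positivity)
              (mul_le_mul_of_nonneg_left (le_max_right _ _) (by norm_num))
        _ = η * δ / 4 := by rw [hκη]; field_simp
        _ ≤ η / 4 := by nlinarith
    obtain ⟨j, hj⟩ := TaSIL.imitationGap_le_iSup (M := fun j => min (ε₁ j) (ε₂ j)) hT hr hpr hstab
      hLp (htaylor _ hstar) (htaylor _ (herm z.1 hz1).1) hμ hα0 hα hnbhd hαp hz2 hM0
      (fun j hj t ht => le_min (hgood j hj _ (Or.inl rfl) t ht) (hgood j hj _ (Or.inr rfl) t ht))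
      hMα hMη
    have hjp : (j : ℕ) ≤ p := Nat.lt_succ_iff.1 j.2
    -- The sign of the logarithm is read off from `0 ≤ ε₁ j`; when `B j = 0`, the quantity `a j` is
    -- simply `0`.
    have ha : 0 ≤ a j := by
      by_contra! hneg
      have h1 : ε₁ j < 0 := mul_neg_of_pos_of_neg (by norm_num)
        (mul_neg_of_pos_of_neg (by positivity) hneg)
      exact absurd (hsize j hjp _ (Or.inl rfl)).1 (not_le.2 h1)
    have h2 := TaSIL.two_mul_div_rpow_le (M := fun j => min (ε₁ j) (ε₂ j)) (a := a) (C := 400)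
      hr hδ (by norm_num) j ha (hM0 j hjp) (min_le_left _ _)
    refine hj.trans ((mul_le_mul_of_nonneg_left h2 hμ.le).trans (le_of_eq ?_))
    rw [← mul_assoc, mul_comm μ]
  refine (measure_mono hcover).trans ((measure_union_le _ _).trans ?_)
  rw [hsupp, zero_add]
  refine (measure_iUnion_fintype_le _ _).trans ?_
  calc _ ≤ ∑ _j : Fin (p + 1), ENNReal.ofReal (δ / (p + 1)) := by
        refine Finset.sum_le_sum fun j _ => (measure_union_le _ _).trans ?_
        have hjp : (j : ℕ) ≤ p := Nat.lt_succ_iff.1 j.2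
        refine (add_le_add (hbad j hjp _ (Or.inl rfl)) (hbad j hjp _ (Or.inr rfl))).trans ?_
        rw [← ENNReal.ofReal_add (by positivity) (by positivity)]
        refine ENNReal.ofReal_le_ofReal (le_of_eq ?_)
        field_simp
        ring
    _ = ENNReal.ofReal δ := by
      rw [Finset.sum_const, Finset.card_univ, Fintype.card_fin, nsmul_eq_mul,
        ← ENNReal.ofReal_natCast, ← ENNReal.ofReal_mul (by positivity)]
      congr 1
      push_cast
      field_simp
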